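/- Graphs are finite and may have loops and parallel edges. A graph is cubic if every vertex has degree $3$ (a loop counts twice). It is cyclically $h$-edge-connected if no edge-cut with fewer than $h$ edges separates two subgraphs both containing a circuit; that is, for every vertex set $W$ such that both $G[W]$ and $G[V(G)\setminus W]$ contain a circuit (a loop and a pair of parallel edges count as circuits), at least $h$ edges have exactly one end in $W$. A $2$-factor of $G$ is a $2$-regular spanning subgraph of $G$. The distance of two subgraphs $G_1,G_2$ of $G$ is $\min\{d(v_1,v_2) : v_1\in V(G_1),\ v_2\in V(G_2)\}$, where $d$ is the length of a shortest path in $G$. Theorem. Let $l\ge 0$ be an integer, let $G$ be a cubic cyclically $\max\{4l-5,2\}$-edge-connected graph, and let $P_1$, $P_2$ and $P_3$ be three paths of $G$ with $l$ edges each, such that the distance of any two of them is at least $\max\{8l-17,0\}$. Then there is a $2$-factor of $G$ that contains at least one of $P_1$, $P_2$, $P_3$. -/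

import Mathlib

/-! Graphs are Mathlib's multigraphs `Graph α β`: loops and parallel edges are allowed. -/

namespace Graph

/-- The degree of a vertex `x`: the number of edges incident with `x`, where a loop at `x`
is counted twice. -/
noncomputable def eDegree {α β : Type*} (G : Graph α β) (x : α) : ℕ∞ :=
  (G.incidenceSet x).encard + (G.loopSet x).encard

/-- Every vertex of `G` has degree `d`. -/
def IsRegularOfDegree {α β : Type*} (G : Graph α β) (d : ℕ) : Prop :=
  ∀ x ∈ G.vertexSet, G.eDegree x = d

/-- A `2`-factor of `G` is a `2`-regular spanning subgraph of `G`. -/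
def IsTwoFactor {α β : Type*} (H G : Graph α β) : Prop :=
  H.IsSpanningSubgraph G ∧ H.IsRegularOfDegree 2

/-- `v 0, e 0, v 1, e 1, …, e (n - 1), v n` is a walk in `G`, of length `n`. -/
structure IsWalk {α β : Type*} (G : Graph α β) {n : ℕ} (v : Fin (n + 1) → α) (e : Fin n → β) :
    Prop where
  vert_mem : ∀ i, v i ∈ G.vertexSet
  isLink : ∀ i : Fin n, G.IsLink (e i) (v i.castSucc) (v i.succ)

/-- A path is a walk without repeated vertices. -/
structure IsPath {α β : Type*} (G : Graph α β) {n : ℕ} (v : Fin (n + 1) → α) (e : Fin n → β) :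
    Prop extends G.IsWalk v e where
  vert_injective : Function.Injective v

/-- `v 0, e 0, v 1, e 1, …, v n, e n, v 0` is a circuit of `G`, of length `n + 1`: addition in
`Fin (n + 1)` is cyclic. A loop is a circuit of length `1`, and two parallel edges form a circuit
of length `2`. -/
structure IsCircuit {α β : Type*} (G : Graph α β) {n : ℕ} (v : Fin (n + 1) → α)
    (e : Fin (n + 1) → β) : Prop where
  isLink : ∀ i, G.IsLink (e i) (v i) (v (i + 1))
  vert_injective : Function.Injective v
  edge_injective : Function.Injective e

/-- The subgraph of `G` induced by the vertex set `W` contains a circuit. -/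
def HasCircuitIn {α β : Type*} (G : Graph α β) (W : Set α) : Prop :=
  ∃ (n : ℕ) (v : Fin (n + 1) → α) (e : Fin (n + 1) → β), G.IsCircuit v e ∧ ∀ i, v i ∈ W

/-- The edge-cut of `G` given by `W`: the edges with exactly one end in `W`. -/
def edgeCut {α β : Type*} (G : Graph α β) (W : Set α) : Set β :=
  {e | ∃ x y, G.IsLink e x y ∧ x ∈ W ∧ y ∉ W}

/-- `G` is cyclically `h`-edge-connected: no edge-cut with fewer than `h` edges separates two
subgraphs both containing a circuit. -/
def IsCyclicallyEdgeConnected {α β : Type*} (G : Graph α β) (h : ℕ) : Prop :=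
  ∀ W ⊆ G.vertexSet, G.HasCircuitIn W → G.HasCircuitIn (G.vertexSet \ W) →
    (h : ℕ∞) ≤ (G.edgeCut W).encard

/-- The distance of two vertices: the least length of a walk between them (`⊤` if there is
none). -/
noncomputable def edist {α β : Type*} (G : Graph α β) (x y : α) : ℕ∞ :=
  ⨅ (n : ℕ) (_ : ∃ (v : Fin (n + 1) → α) (e : Fin n → β),
    G.IsWalk v e ∧ v 0 = x ∧ v (Fin.last n) = y), (n : ℕ∞)

/-- The distance of two subgraphs with vertex sets `S` and `T`: the least distance in `G` of a
vertex of `S` and a vertex of `T`. -/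
noncomputable def setEDist {α β : Type*} (G : Graph α β) (S T : Set α) : ℕ∞ :=
  ⨅ (x ∈ S) (y ∈ T), G.edist x y

end Graph

/-!
Let `P` be a path with edge set `F` in the cubic graph `G`. Deleting a perfect matching of `G - F`
from `G` leaves a `2`-factor containing `P`, so suppose that none of the three graphs `G - F` has a
perfect matching.

*Barriers.* By Tutte's theorem `G - F` has a vertex set `S` whose deletion leaves at least
`#S + 2` odd pieces. Take `S` as large as possible. Then all vertices outside `S` lie in odd pieces,
and each piece either is a single vertex or has minimum degree two. A piece of the latter kind
contains a circuit, and counting the edges between `S` and the pieces together with the cyclic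
edge-connectivity excludes it (`IsOddFamily.IsMaximal.card_lt_three`). So the complement `A` of `S`
spans only edges of `P`, and as `G` is cubic, `#A = #S + 2` says that the edges inside `A` exceed
the edges inside `Aᶜ` by three (`exists_card_inner_eq`). In particular `P` has at least three edges,
and at most `2l - 3` edges are monochromatic for the colouring `A`, `Aᶜ`.

*Comparison.* Let `A` and `B` be the sets obtained from two of the paths. An edge leaving the set of
vertices at which the two colourings agree is monochromatic for one of them, so there are at most
`4l - 6` such edges, fewer than cyclic edge-connectivity allows between two circuits. Hence the
colourings agree, or are opposite, outside a set `X` of at most `4l - 8` vertices. Let `Z` be the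
part of `X` together with the second path that is reachable from that path. The first path is too
far away to meet `Z`, so `Z` has few leaving edges, and cyclic edge-connectivity says that it has
at least `#Z + 2` of them. Counting edges at the colour classes in `Z` shows that the edges inside
`B` number at most twice those inside `Aᶜ` plus those inside `Bᶜ`, where only edges close to the
second path are counted (`card_inner_le_of_far`).

*Conclusion.* Write `B k` for the set obtained from the path `k`. Since edges close to different
paths are different, adding up the estimates for the six ordered pairs shows that the edges inside
the sets `B k` number at most as many as those inside the sets `(B k)ᶜ`, against the excess of three
in each of them (`exists_isPerfectMatching_avoid`).

Cyclic edge-connectivity is used only through `CutBound`: a forest on `n ≥ 1` vertices in a cubic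
graph is left by at least `n + 2` edges, so every cut is large or has a side that is small
compared with it. All counting takes place in the auxiliary structure `Multigraph`, in which
the ends of the edges are given by two functions.
-/

/-! ### Edge counting in cubic multigraphs -/

/-- A multigraph with vertex type `V` and edge type `E`, every edge being given with an arbitrary
order of its two ends. A loop has `fst e = snd e`. The order lets edge counts be written as sums
over `E`; it carries no other meaning. -/
structure Multigraph (V E : Type*) where
  /-- The first end of an edge. -/
  fst : E → V
  /-- The second end of an edge. -/
  snd : E → V

namespace Multigraph

open Finset
open scoped Classical

set_option linter.unusedSectionVars false

variable {V E : Type*} (M : Multigraph V E)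

/-- `x` and `y` are the two ends of the edge `e`. -/
def Joins (e : E) (x y : V) : Prop :=
  (M.fst e = x ∧ M.snd e = y) ∨ (M.fst e = y ∧ M.snd e = x)

variable {M} in
lemma Joins.symm {e : E} {x y : V} (h : M.Joins e x y) : M.Joins e y x := Or.symm h

lemma joins_fst_snd (e : E) : M.Joins e (M.fst e) (M.snd e) := Or.inl ⟨rfl, rfl⟩

/-- The number of ends of the edge `e` in the vertex set `W`: a loop in `W` has two. -/
noncomputable def ends (W : Finset V) (e : E) : ℕ :=
  (if M.fst e ∈ W then 1 else 0) + (if M.snd e ∈ W then 1 else 0)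

variable {M} in
lemma Joins.ends_eq {e : E} {x y : V} (h : M.Joins e x y) (W : Finset V) :
    M.ends W e = (if x ∈ W then 1 else 0) + (if y ∈ W then 1 else 0) := by
  unfold ends
  rcases h with ⟨rfl, rfl⟩ | ⟨rfl, rfl⟩
  · rfl
  · exact Nat.add_comm _ _

variable [Fintype E]

/-- Every vertex has degree three, loops being counted twice. -/
def IsCubic : Prop := ∀ v, ∑ e, M.ends {v} e = 3

lemma ends_eq_sum (W : Finset V) (e : E) : M.ends W e = ∑ v ∈ W, M.ends {v} e := by
  simp [ends, Finset.sum_add_distrib]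

/-- The edges with both ends in `W`. -/
noncomputable def inner (W : Finset V) : Finset E := {e | M.fst e ∈ W ∧ M.snd e ∈ W}

/-- The edges with exactly one end in `W`. -/
noncomputable def cut (W : Finset V) : Finset E := {e | ¬(M.fst e ∈ W ↔ M.snd e ∈ W)}

/-- The edges with at least one end in `W`. -/
noncomputable def touching (W : Finset V) : Finset E := {e | M.fst e ∈ W ∨ M.snd e ∈ W}

lemma mem_inner {W : Finset V} {e : E} : e ∈ M.inner W ↔ M.fst e ∈ W ∧ M.snd e ∈ W := by
  simp [inner]

lemma mem_cut {W : Finset V} {e : E} : e ∈ M.cut W ↔ ¬(M.fst e ∈ W ↔ M.snd e ∈ W) := by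
  simp [cut]

lemma mem_touching {W : Finset V} {e : E} :
    e ∈ M.touching W ↔ M.fst e ∈ W ∨ M.snd e ∈ W := by
  simp [touching]

variable {M} in
lemma Joins.mem_inner {e : E} {x y : V} (h : M.Joins e x y) {W : Finset V} :
    e ∈ M.inner W ↔ x ∈ W ∧ y ∈ W := by
  rw [M.mem_inner]
  rcases h with ⟨rfl, rfl⟩ | ⟨rfl, rfl⟩ <;> tauto

variable {M} in
lemma Joins.mem_cut {e : E} {x y : V} (h : M.Joins e x y) {W : Finset V} :
    e ∈ M.cut W ↔ ¬(x ∈ W ↔ y ∈ W) := by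
  rw [M.mem_cut]
  rcases h with ⟨rfl, rfl⟩ | ⟨rfl, rfl⟩ <;> tauto

variable {M} in
lemma Joins.mem_touching {e : E} {x y : V} (h : M.Joins e x y) {W : Finset V} :
    e ∈ M.touching W ↔ x ∈ W ∨ y ∈ W := by
  rw [M.mem_touching]
  rcases h with ⟨rfl, rfl⟩ | ⟨rfl, rfl⟩ <;> tauto

lemma exists_joins_of_mem_cut {W : Finset V} {e : E} (h : e ∈ M.cut W) :
    ∃ x ∈ W, ∃ y ∉ W, M.Joins e x y := by
  rw [mem_cut] at h
  by_cases h1 : M.fst e ∈ W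
  · exact ⟨_, h1, M.snd e, by tauto, M.joins_fst_snd e⟩
  · exact ⟨M.snd e, by tauto, M.fst e, h1, (M.joins_fst_snd e).symm⟩

lemma exists_joins_of_mem_touching {W : Finset V} {e : E} (h : e ∈ M.touching W) :
    ∃ x ∈ W, ∃ y, M.Joins e x y := by
  rw [mem_touching] at h
  rcases h with h | h
  · exact ⟨_, h, _, M.joins_fst_snd e⟩
  · exact ⟨_, h, _, (M.joins_fst_snd e).symm⟩

lemma ends_pos_iff {W : Finset V} {e : E} : 0 < M.ends W e ↔ e ∈ M.touching W := by
  rw [mem_touching]; unfold ends; split_ifs <;> simp_all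

variable {M}

lemma IsCubic.sum_ends (hM : M.IsCubic) (W : Finset V) : ∑ e, M.ends W e = 3 * #W := by
  simp_rw [M.ends_eq_sum W]
  rw [Finset.sum_comm, Finset.sum_congr rfl fun v _ ↦ hM v]
  simp [mul_comm]

lemma sum_ends_eq (W : Finset V) : ∑ e, M.ends W e = 2 * #(M.inner W) + #(M.cut W) := by
  rw [inner, cut, Finset.card_filter, Finset.card_filter, Finset.mul_sum, ← Finset.sum_add_distrib]
  refine Finset.sum_congr rfl fun e _ ↦ ?_
  unfold ends
  by_cases h1 : M.fst e ∈ W <;> by_cases h2 : M.snd e ∈ W <;> simp [h1, h2]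

lemma IsCubic.two_mul_card_inner (hM : M.IsCubic) (W : Finset V) :
    2 * #(M.inner W) + #(M.cut W) = 3 * #W := by
  rw [← sum_ends_eq, hM.sum_ends]

/-- A circuit of length `n + 1` with all its vertices in `W`; the vertices and edges are the
values of `v` and `e` on `0, …, n`. -/
def HasCircuit (M : Multigraph V E) (W : Finset V) : Prop :=
  ∃ (n : ℕ) (v : ℕ → V) (e : ℕ → E), (∀ i < n, M.Joins (e i) (v i) (v (i + 1))) ∧
    M.Joins (e n) (v n) (v 0) ∧ Set.InjOn v (Set.Iic n) ∧ Set.InjOn e (Set.Iic n) ∧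
    ∀ i ≤ n, v i ∈ W

/-- In a path of maximal length inside `W`, a second edge at the last vertex leads back to the
path and closes a circuit. -/
lemma hasCircuit_of_two_le (W : Finset V) (hW : W.Nonempty)
    (h : ∀ w ∈ W, 2 ≤ ∑ e ∈ M.inner W, M.ends {w} e) : M.HasCircuit W := by
  let P : ℕ → Prop := fun n ↦ ∃ (v : ℕ → V) (e : ℕ → E),
    (∀ i < n, M.Joins (e i) (v i) (v (i + 1))) ∧ Set.InjOn v (Set.Iic n) ∧ ∀ i ≤ n, v i ∈ W
  have hne : Nonempty E := by
    by_contra hE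
    rw [not_nonempty_iff] at hE
    obtain ⟨w, hw⟩ := hW
    have := h w hw
    simp [Finset.eq_empty_of_isEmpty (M.inner W)] at this
  obtain ⟨n, hn, hn'⟩ : ∃ n, P n ∧ ¬P (n + 1) := by
    by_contra! hcon
    have hall : ∀ n, P n := by
      intro n
      induction n with
      | zero =>
        obtain ⟨w, hw⟩ := hW
        refine ⟨fun _ ↦ w, fun _ ↦ hne.some, by simp, ?_, fun _ _ ↦ hw⟩
        intro i hi j hj _
        simp at hi hj; omega
      | succ n ih => exact hcon n ih
    obtain ⟨v, e, -, hv, hvW⟩ := hall #W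
    have := Finset.card_le_card_of_injOn (s := Finset.range (#W + 1)) (t := W) v
      (fun i hi ↦ hvW i (by simp at hi; omega))
      (fun i hi j hj hij ↦ hv (by simp at hi ⊢; omega) (by simp at hj ⊢; omega) hij)
    simp at this
  obtain ⟨v, e, hJ, hv, hvW⟩ := hn
  obtain ⟨f, hf, hft, hfne⟩ : ∃ f ∈ M.inner W, f ∈ M.touching {v n} ∧ ∀ i < n, f ≠ e i := by
    by_contra! hcon
    have h2 := h (v n) (hvW n le_rfl)
    have key : ∀ f ∈ M.inner W, f ∈ M.touching {v n} → 0 < n ∧ f = e (n - 1) := by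
      intro f hf hft
      obtain ⟨i, hi, rfl⟩ := hcon f hf hft
      rw [(hJ i hi).mem_touching] at hft
      simp only [Finset.mem_singleton] at hft
      rcases hft with hft | hft
      · have := hv (by simp; omega) (by simp) hft; omega
      · have := hv (by simp; omega) (by simp) hft
        exact ⟨by omega, by congr 1; omega⟩
    have h3 : ∑ f ∈ M.inner W, M.ends {v n} f ≤ 1 := by
      rcases Nat.eq_zero_or_pos n with h0 | h0
      · rw [Finset.sum_eq_zero]
        · exact Nat.zero_le _
        intro f hf
        by_contra hne
        have := key f hf (M.ends_pos_iff.1 (Nat.pos_of_ne_zero hne))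
        omega
      · calc ∑ f ∈ M.inner W, M.ends {v n} f ≤ ∑ f ∈ {e (n - 1)}, M.ends {v n} f := by
              refine Finset.sum_le_sum_of_ne_zero fun f hf hne ↦ ?_
              simpa using (key f hf (M.ends_pos_iff.1 (Nat.pos_of_ne_zero hne))).2
          _ ≤ 1 := by
              rw [Finset.sum_singleton, (hJ (n - 1) (by omega)).ends_eq, if_neg]
              · split_ifs <;> omega
              · intro hmem
                have := hv (by simp) (by simp) (Finset.mem_singleton.1 hmem)
                omega
    omega
  obtain ⟨x, hx, w, hfw⟩ := M.exists_joins_of_mem_touching hft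
  obtain rfl := Finset.mem_singleton.1 hx
  have hwW : w ∈ W := (hfw.mem_inner.1 hf).2
  obtain ⟨k, hk, hkw⟩ : ∃ k ≤ n, v k = w := by
    by_contra! hcon
    refine hn' ⟨fun i ↦ if i = n + 1 then w else v i, fun i ↦ if i = n then f else e i, ?_, ?_, ?_⟩
    · intro i hi
      rcases Nat.lt_succ_iff_lt_or_eq.1 hi with hi | rfl
      · simpa [show i ≠ n by omega, show i ≠ n + 1 by omega] using hJ i hi
      · simpa using hfw
    · intro i hi j hj hij
      simp only [Set.mem_Iic] at hi hj
      dsimp only at hij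
      split_ifs at hij with h1 h2 h2
      · omega
      · exact absurd hij.symm (hcon j (by omega))
      · exact absurd hij (hcon i (by omega))
      · exact hv (by simp; omega) (by simp; omega) hij
    · intro i hi
      dsimp only
      split_ifs
      · exact hwW
      · exact hvW i (by omega)
  refine ⟨n - k, fun i ↦ v (k + i), fun i ↦ if k + i = n then f else e (k + i), ?_, ?_, ?_, ?_, ?_⟩
  · intro i hi
    simpa [show k + i ≠ n by omega, add_assoc] using hJ (k + i) (by omega)
  · simpa [show k + (n - k) = n by omega, hkw] using hfw
  · intro i hi j hj hij
    simp only [Set.mem_Iic] at hi hj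
    have := hv (by simp; omega) (by simp; omega) hij
    omega
  · have hinj : ∀ i < n, ∀ j < n, e i = e j → i = j := by
      intro i hi j hj hij
      have h1 := hJ i hi
      have h2 := hJ j hj
      rw [hij] at h1
      have hh : ∀ a b, a ≤ n → b ≤ n → v a = v b → a = b := fun a b ha hb hab ↦
        hv (by simpa using ha) (by simpa using hb) hab
      rcases h1 with ⟨a1, b1⟩ | ⟨a1, b1⟩ <;> rcases h2 with ⟨a2, b2⟩ | ⟨a2, b2⟩
      · exact hh _ _ (by omega) (by omega) (a1.symm.trans a2)
      · have := hh _ _ (by omega) (by omega) (a1.symm.trans a2)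
        have := hh _ _ (by omega) (by omega) (b1.symm.trans b2)
        omega
      · have := hh _ _ (by omega) (by omega) (a1.symm.trans a2)
        have := hh _ _ (by omega) (by omega) (b1.symm.trans b2)
        omega
      · exact hh _ _ (by omega) (by omega) (b1.symm.trans b2)
    intro i hi j hj hij
    simp only [Set.mem_Iic] at hi hj
    dsimp only at hij
    split_ifs at hij with h1 h2 h2
    · omega
    · exact absurd hij (hfne _ (by omega))
    · exact absurd hij.symm (hfne _ (by omega))
    · have := hinj _ (by omega) _ (by omega) hij
      omega
  · intro i hi
    exact hvW _ (by omega)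

lemma HasCircuit.mono {W W' : Finset V} (h : M.HasCircuit W) (hW : W ⊆ W') :
    M.HasCircuit W' := by
  obtain ⟨n, v, e, h1, h2, h3, h4, h5⟩ := h
  exact ⟨n, v, e, h1, h2, h3, h4, fun i hi ↦ hW (h5 i hi)⟩

/-- A nonempty forest has fewer edges than vertices. -/
lemma card_inner_lt_of_not_hasCircuit (W : Finset V) (hW : W.Nonempty)
    (h : ¬M.HasCircuit W) : #(M.inner W) + 1 ≤ #W := by
  induction hn : #W generalizing W with
  | zero => simp_all
  | succ n ih =>
    have : ∃ w ∈ W, ∑ e ∈ M.inner W, M.ends {w} e ≤ 1 := by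
      by_contra! hcon
      exact h (hasCircuit_of_two_le W hW hcon)
    obtain ⟨w, hw, hw1⟩ := this
    have hcard : #(W.erase w) = n := by rw [Finset.card_erase_of_mem hw]; omega
    have hin : #(M.inner W) ≤ #(M.inner (W.erase w)) + 1 := by
      have h1 : M.inner W ⊆ M.inner (W.erase w) ∪ {e ∈ M.inner W | 0 < M.ends {w} e} := by
        intro e he
        simp only [Finset.mem_union, Finset.mem_filter, M.ends_pos_iff, M.mem_touching,
          M.mem_inner, Finset.mem_erase, Finset.mem_singleton] at he ⊢
        tauto
      have h2 : #{e ∈ M.inner W | 0 < M.ends {w} e} ≤ ∑ e ∈ M.inner W, M.ends {w} e := by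
        rw [Finset.card_filter]
        exact Finset.sum_le_sum fun e _ ↦ by split_ifs <;> omega
      have := (Finset.card_le_card h1).trans (Finset.card_union_le _ _)
      omega
    rcases Finset.eq_empty_or_nonempty (W.erase w) with h0 | h0
    · have hWw : W = {w} := by
        refine Finset.eq_singleton_iff_unique_mem.2 ⟨hw, fun x hx ↦ ?_⟩
        by_contra hne
        have : x ∈ W.erase w := Finset.mem_erase.2 ⟨hne, hx⟩
        simp [h0] at this
      have h2 : 2 * #(M.inner W) ≤ ∑ e ∈ M.inner W, M.ends {w} e := by
        rw [mul_comm, ← smul_eq_mul]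
        refine Finset.card_nsmul_le_sum _ _ _ fun e he ↦ ?_
        rw [M.mem_inner, hWw] at he
        simp [ends, Finset.mem_singleton.1 he.1, Finset.mem_singleton.1 he.2]
      omega
    · have := ih (W.erase w) h0 (fun hc ↦ h (hc.mono (Finset.erase_subset _ _))) hcard
      omega

lemma IsCubic.card_add_two_le_of_not_hasCircuit (hM : M.IsCubic) (W : Finset V)
    (hW : W.Nonempty) (h : ¬M.HasCircuit W) : #W + 2 ≤ #(M.cut W) := by
  have := card_inner_lt_of_not_hasCircuit W hW h
  have := hM.two_mul_card_inner W
  omega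

variable [Fintype V]

lemma mem_cut_compl {W : Finset V} : M.cut Wᶜ = M.cut W := by
  ext e; simp only [mem_cut, Finset.mem_compl]; tauto

/-- Both sides of an edge cut of a cubic multigraph contain a circuit unless one of them is a
forest, whose number of vertices is then controlled by the size of the cut. This is the only form
in which cyclic edge-connectivity enters the argument. -/
def CutBound (M : Multigraph V E) (h : ℕ) : Prop :=
  ∀ W : Finset V, W.Nonempty → Wᶜ.Nonempty →
    h ≤ #(M.cut W) ∨ #W + 2 ≤ #(M.cut W) ∨ #Wᶜ + 2 ≤ #(M.cut W)

lemma IsCubic.cutBound (hM : M.IsCubic) {h : ℕ}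
    (hc : ∀ W : Finset V, M.HasCircuit W → M.HasCircuit Wᶜ → h ≤ #(M.cut W)) :
    M.CutBound h := by
  intro W hW hW'
  by_cases h1 : M.HasCircuit W
  · by_cases h2 : M.HasCircuit Wᶜ
    · exact Or.inl (hc W h1 h2)
    · have := hM.card_add_two_le_of_not_hasCircuit _ hW' h2
      rw [mem_cut_compl] at this
      exact Or.inr (Or.inr this)
  · exact Or.inr (Or.inl (hM.card_add_two_le_of_not_hasCircuit W hW h1))

/-! ### Paths -/

/-- `pv 0, pe 0, pv 1, …, pv l` is a path. -/
structure IsPath (M : Multigraph V E) {l : ℕ} (pv : Fin (l + 1) → V) (pe : Fin l → E) :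
    Prop where
  injective : Function.Injective pv
  joins : ∀ i : Fin l, M.Joins (pe i) (pv i.castSucc) (pv i.succ)

namespace IsPath

variable {l : ℕ} {pv : Fin (l + 1) → V} {pe : Fin l → E}

lemma edge_injective (hP : M.IsPath pv pe) : Function.Injective pe := by
  intro i j hij
  have h1 := hP.joins i
  have h2 := hP.joins j
  rw [hij] at h1
  have hh : ∀ a b, pv a = pv b → (a : ℕ) = b := fun a b hab ↦ by rw [hP.injective hab]
  ext
  rcases h1 with ⟨a1, b1⟩ | ⟨a1, b1⟩ <;> rcases h2 with ⟨a2, b2⟩ | ⟨a2, b2⟩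
  · simpa using hh _ _ (a1.symm.trans a2)
  · have := hh _ _ (a1.symm.trans a2)
    have := hh _ _ (b1.symm.trans b2)
    simp at *; omega
  · have := hh _ _ (a1.symm.trans a2)
    have := hh _ _ (b1.symm.trans b2)
    simp at *; omega
  · simpa using hh _ _ (b1.symm.trans b2)

lemma card_verts (hP : M.IsPath pv pe) : #(univ.image pv) = l + 1 := by
  rw [Finset.card_image_of_injective _ hP.injective]; simp

lemma card_edges (hP : M.IsPath pv pe) : #(univ.image pe) = l := by
  rw [Finset.card_image_of_injective _ hP.edge_injective]; simp

/-- The number of ends of the edges of a path in `W`: two for each vertex of the path in `W`,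
except that the end vertices of the path have only one. -/
lemma sum_ends_add (hP : M.IsPath pv pe) (W : Finset V) :
    ∑ e ∈ univ.image pe, M.ends W e + (if pv 0 ∈ W then 1 else 0)
      + (if pv (Fin.last l) ∈ W then 1 else 0) = 2 * #(W ∩ univ.image pv) := by
  have h1 : #(W ∩ univ.image pv) = ∑ i, if pv i ∈ W then 1 else 0 := by
    rw [← Finset.card_filter, ← Finset.card_image_of_injective _ hP.injective]
    congr 1
    ext x
    simp only [Finset.mem_inter, Finset.mem_image, Finset.mem_univ, true_and, Finset.mem_filter]
    constructor
    · rintro ⟨hx, i, rfl⟩; exact ⟨i, hx, rfl⟩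
    · rintro ⟨i, hx, rfl⟩; exact ⟨hx, i, rfl⟩
  rw [Finset.sum_image fun i _ j _ hij ↦ hP.edge_injective hij, h1,
    Finset.sum_congr rfl fun i _ ↦ (hP.joins i).ends_eq W, Finset.sum_add_distrib, two_mul]
  have h2 := Fin.sum_univ_castSucc fun i ↦ if pv i ∈ W then 1 else 0
  have h3 := Fin.sum_univ_succ fun i ↦ if pv i ∈ W then 1 else 0
  omega

lemma sum_ends_le (hP : M.IsPath pv pe) (W : Finset V) :
    ∑ e ∈ univ.image pe, M.ends W e ≤ 2 * #(W ∩ univ.image pv) := by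
  have := hP.sum_ends_add W; omega

lemma le_sum_ends (hP : M.IsPath pv pe) (W : Finset V) :
    2 * #(W ∩ univ.image pv) ≤ ∑ e ∈ univ.image pe, M.ends W e + 2 := by
  have := hP.sum_ends_add W; split_ifs at this <;> omega

lemma edges_subset_inner (hP : M.IsPath pv pe) :
    univ.image pe ⊆ M.inner (univ.image pv) := by
  intro e he
  obtain ⟨i, -, rfl⟩ := Finset.mem_image.1 he
  exact (hP.joins i).mem_inner.2 ⟨by simp, by simp⟩

end IsPath

/-! ### Tutte barriers avoiding a path -/

/-- The simple graph underlying `M` without the edges in `F`. -/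
def avoid (M : Multigraph V E) (F : Finset E) : SimpleGraph V where
  Adj x y := x ≠ y ∧ ∃ e ∉ F, M.Joins e x y
  symm := ⟨fun _ _ ⟨h, e, he, hJ⟩ ↦ ⟨h.symm, e, he, hJ.symm⟩⟩
  loopless := ⟨fun _ h ↦ h.1 rfl⟩

/-- `𝒞` is a family of pairwise disjoint vertex sets of odd size, each of them a union of
components of `M - F - S`. Working with such families rather than with components makes it easy to
move a vertex to `S`: the remaining pieces need not be connected. -/
structure IsOddFamily (M : Multigraph V E) (F : Finset E) (S : Finset V)
    (𝒞 : Finset (Finset V)) : Prop where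
  odd : ∀ C ∈ 𝒞, Odd #C
  disj : ∀ C ∈ 𝒞, Disjoint C S
  closed : ∀ C ∈ 𝒞, ∀ x ∈ C, ∀ y ∉ S, ∀ e ∉ F, M.Joins e x y → y ∈ C
  pairwise : (𝒞 : Set (Finset V)).PairwiseDisjoint id

lemma exists_isOddFamily_of_not_isPerfectMatching (F : Finset E)
    (h : ¬∃ N : (M.avoid F).Subgraph, N.IsPerfectMatching) :
    ∃ S 𝒞, M.IsOddFamily F S 𝒞 ∧ #S < #𝒞 := by
  rw [SimpleGraph.tutte] at h
  push Not at h
  obtain ⟨u, hu⟩ := h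
  unfold SimpleGraph.IsTutteViolator at hu
  set H := ((⊤ : (M.avoid F).Subgraph).deleteVerts u) with hH
  let f : H.coe.ConnectedComponent → Finset V :=
    fun c ↦ Set.toFinset ((Subtype.val : H.verts → V) '' c.supp)
  have hmem : ∀ c x, x ∈ f c ↔ ∃ hx : x ∈ H.verts, H.coe.connectedComponentMk ⟨x, hx⟩ = c := by
    intro c x
    simp [f]
  have hverts : ∀ x, x ∈ H.verts ↔ x ∉ u := by simp [hH]
  have hdisj : ∀ c c', c ≠ c' → Disjoint (f c) (f c') := by
    intro c c' hcc
    rw [Finset.disjoint_left]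
    intro x hx hx'
    rw [hmem] at hx hx'
    obtain ⟨h1, h2⟩ := hx
    obtain ⟨h3, h4⟩ := hx'
    exact hcc (h2.symm.trans h4)
  have hcard : ∀ c, #(f c) = c.supp.ncard := by
    intro c
    rw [← Set.ncard_image_of_injective _ Subtype.val_injective, Set.ncard_eq_toFinset_card']
  have hinj : Function.Injective f := by
    intro c c' hcc
    by_contra hne
    have h1 := hdisj c c' hne
    rw [hcc, Finset.disjoint_self_iff_empty] at h1
    obtain ⟨x, hx⟩ := c'.nonempty_supp
    have : x.1 ∈ f c' := (hmem _ _).2 ⟨x.2, hx⟩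
    simp [h1] at this
  refine ⟨u.toFinset, Finset.image f H.coe.oddComponents.toFinset, ⟨?_, ?_, ?_, ?_⟩, ?_⟩
  · intro C hC
    obtain ⟨c, hc, rfl⟩ := Finset.mem_image.1 hC
    rw [hcard]
    simpa using hc
  · intro C hC
    obtain ⟨c, hc, rfl⟩ := Finset.mem_image.1 hC
    rw [Finset.disjoint_left]
    intro x hx hxu
    obtain ⟨h1, -⟩ := (hmem _ _).1 hx
    exact (hverts x).1 h1 (by simpa using hxu)
  · intro C hC x hx y hy e he hJ
    obtain ⟨c, hc, rfl⟩ := Finset.mem_image.1 hC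
    by_cases hxy : x = y
    · exact hxy ▸ hx
    obtain ⟨h1, h2⟩ := (hmem _ _).1 hx
    have hy' : y ∉ u := by simpa using hy
    refine (hmem _ _).2 ⟨(hverts y).2 hy', ?_⟩
    rw [← h2]
    refine SimpleGraph.ConnectedComponent.sound (SimpleGraph.Adj.reachable ?_)
    have hx' := (hverts x).1 h1
    have hadj : (M.avoid F).Adj y x := ⟨Ne.symm hxy, e, he, hJ.symm⟩
    simp [hH, hadj, hx', hy']
  · intro C hC C' hC' hne
    obtain ⟨c, hc, rfl⟩ := Finset.mem_image.1 hC
    obtain ⟨c', hc', rfl⟩ := Finset.mem_image.1 hC'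
    exact hdisj c c' fun h ↦ hne (by rw [h])
  · rw [Finset.card_image_of_injective _ hinj, ← Set.ncard_eq_toFinset_card',
      ← Set.ncard_eq_toFinset_card']
    exact hu

namespace IsOddFamily

variable {F : Finset E} {S : Finset V} {𝒞 : Finset (Finset V)}

lemma subset (h : M.IsOddFamily F S 𝒞) {𝒟 : Finset (Finset V)} (hs : 𝒟 ⊆ 𝒞) :
    M.IsOddFamily F S 𝒟 :=
  ⟨fun C hC ↦ h.odd C (hs hC), fun C hC ↦ h.disj C (hs hC), fun C hC ↦ h.closed C (hs hC),
    h.pairwise.subset (by exact_mod_cast hs)⟩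

/-- Enlarging `S` by a vertex outside all the members of the family. -/
lemma insert_right (h : M.IsOddFamily F S 𝒞) {v : V} (hv : ∀ C ∈ 𝒞, v ∉ C) :
    M.IsOddFamily F (insert v S) 𝒞 := by
  refine ⟨h.odd, fun C hC ↦ ?_, fun C hC x hx y hy e he hJ ↦ ?_, h.pairwise⟩
  · rw [Finset.disjoint_insert_right]
    exact ⟨hv C hC, h.disj C hC⟩
  · exact h.closed C hC x hx y (fun hyS ↦ hy (Finset.mem_insert_of_mem hyS)) e he hJ

lemma insert_left (h : M.IsOddFamily F S 𝒞) {D : Finset V} (hD : Odd #D) (hDS : Disjoint D S)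
    (hcl : ∀ x ∈ D, ∀ y ∉ S, ∀ e ∉ F, M.Joins e x y → y ∈ D)
    (hd : ∀ C ∈ 𝒞, Disjoint D C) :
    M.IsOddFamily F S (insert D 𝒞) ∧ #(insert D 𝒞) = #𝒞 + 1 := by
  constructor
  · refine ⟨?_, ?_, ?_, ?_⟩
    · intro C hC
      rcases Finset.mem_insert.1 hC with rfl | hC
      exacts [hD, h.odd C hC]
    · intro C hC
      rcases Finset.mem_insert.1 hC with rfl | hC
      exacts [hDS, h.disj C hC]
    · intro C hC
      rcases Finset.mem_insert.1 hC with rfl | hC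
      exacts [hcl, h.closed C hC]
    · rw [Finset.coe_insert]
      exact h.pairwise.insert fun C hC _ ↦ hd C hC
  · refine Finset.card_insert_of_notMem fun hmem ↦ ?_
    have := hd D hmem
    rw [Finset.disjoint_self_iff_empty] at this
    simp [this] at hD

/-- The vertices outside `S` and outside the members of the family. -/
noncomputable def rest (S : Finset V) (𝒞 : Finset (Finset V)) : Finset V :=
  (S ∪ 𝒞.biUnion id)ᶜ

lemma mem_rest {v : V} : v ∈ rest S 𝒞 ↔ v ∉ S ∧ ∀ C ∈ 𝒞, v ∉ C := by
  simp [rest]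

lemma rest_closed (h : M.IsOddFamily F S 𝒞) :
    ∀ x ∈ rest S 𝒞, ∀ y ∉ S, ∀ e ∉ F, M.Joins e x y → y ∈ rest S 𝒞 := by
  intro x hx y hy e he hJ
  rw [mem_rest] at hx ⊢
  exact ⟨hy, fun C hC hyC ↦ hx.2 C hC (h.closed C hC y hyC x hx.1 e he hJ.symm)⟩

lemma odd_card_biUnion_iff (h : M.IsOddFamily F S 𝒞) : Odd #(𝒞.biUnion id) ↔ Odd #𝒞 := by
  rw [Finset.card_biUnion h.pairwise, Finset.odd_sum_iff_odd_card_odd]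
  rw [Finset.filter_true_of_mem (p := fun C ↦ Odd #(id C)) fun C hC ↦ h.odd C hC]

lemma card_add (h : M.IsOddFamily F S 𝒞) :
    #S + #(𝒞.biUnion id) + #(rest S 𝒞) = Fintype.card V := by
  rw [← Finset.card_union_of_disjoint, rest, Finset.card_add_card_compl]
  rw [Finset.disjoint_biUnion_right]
  exact fun C hC ↦ (h.disj C hC).symm

lemma exists_card_eq (h : M.IsOddFamily F S 𝒞) (hlt : #S < #𝒞) (hV : Even (Fintype.card V)) :
    ∃ 𝒟, M.IsOddFamily F S 𝒟 ∧ #𝒟 = #S + 2 := by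
  rcases Nat.lt_or_ge (#S + 1) #𝒞 with hlt' | hge
  · obtain ⟨𝒟, hs, hc⟩ := Finset.exists_subset_card_eq (show #S + 2 ≤ #𝒞 by omega)
    exact ⟨𝒟, h.subset hs, hc⟩
  · have h1 := h.odd_card_biUnion_iff
    have h2 := h.card_add
    have h3 : Odd #(rest S 𝒞) := by
      simp only [Nat.odd_iff, Nat.even_iff] at h1 hV ⊢; omega
    obtain ⟨h4, h5⟩ := h.insert_left h3 (Finset.disjoint_left.2 fun x hx ↦ (mem_rest.1 hx).1)
      h.rest_closed (fun C hC ↦ Finset.disjoint_left.2 fun x hx ↦ (mem_rest.1 hx).2 C hC)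
    exact ⟨_, h4, by omega⟩

/-- The family is a barrier with deficiency two, and `S` is as large as possible. -/
def IsMaximal (M : Multigraph V E) (F : Finset E) (S : Finset V) (𝒞 : Finset (Finset V)) : Prop :=
  M.IsOddFamily F S 𝒞 ∧ #𝒞 = #S + 2 ∧
    ∀ S' 𝒞', M.IsOddFamily F S' 𝒞' → #𝒞' = #S' + 2 → #S' ≤ #S

lemma exists_isMaximal (h : M.IsOddFamily F S 𝒞) (hlt : #S < #𝒞) (hV : Even (Fintype.card V)) :
    ∃ S' 𝒞', IsMaximal M F S' 𝒞' := by
  obtain ⟨𝒟, h𝒟, hc⟩ := h.exists_card_eq hlt hV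
  obtain ⟨⟨S', 𝒞'⟩, hmem, hmax⟩ := Finset.exists_max_image
    ({p | M.IsOddFamily F p.1 p.2 ∧ #p.2 = #p.1 + 2} : Finset (Finset V × Finset (Finset V)))
    (fun p ↦ #p.1) ⟨(S, 𝒟), by simp [h𝒟, hc]⟩
  simp only [Finset.mem_filter, Finset.mem_univ, true_and] at hmem hmax
  exact ⟨S', 𝒞', hmem.1, hmem.2, fun S'' 𝒞'' h1 h2 ↦ hmax (S'', 𝒞'') ⟨h1, h2⟩⟩

/-- An even remainder could be turned into one more odd piece by moving one of its vertices
to `S`. -/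
lemma IsMaximal.rest_eq_empty (h : IsMaximal M F S 𝒞) (hV : Even (Fintype.card V)) :
    rest S 𝒞 = ∅ := by
  obtain ⟨hf, hc, hmax⟩ := h
  by_contra hne
  obtain ⟨v, hv⟩ := Finset.nonempty_iff_ne_empty.2 hne
  have hv' := mem_rest.1 hv
  have h1 := hf.odd_card_biUnion_iff
  have h2 := hf.card_add
  have h3 : Odd #((rest S 𝒞).erase v) := by
    rw [Finset.card_erase_of_mem hv]
    have hpos := Finset.card_pos.2 ⟨v, hv⟩
    simp only [Nat.odd_iff, Nat.even_iff] at h1 hV ⊢; omega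
  have hdis : Disjoint ((rest S 𝒞).erase v) (insert v S) := by
    rw [Finset.disjoint_left]
    intro x hx
    simp only [Finset.mem_erase, mem_rest, Finset.mem_insert] at hx ⊢
    tauto
  obtain ⟨h4, h5⟩ := (hf.insert_right hv'.2).insert_left h3 hdis
    (by
      intro x hx y hy e he hJ
      simp only [Finset.mem_insert, not_or] at hy
      exact Finset.mem_erase.2
        ⟨hy.1, hf.rest_closed x (Finset.mem_of_mem_erase hx) y hy.2 e he hJ⟩)
    (by
      intro C hC
      rw [Finset.disjoint_left]
      intro x hx
      exact (mem_rest.1 (Finset.mem_of_mem_erase hx)).2 C hC)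
  have h6 := Finset.card_insert_of_notMem hv'.1
  have := hmax _ _ h4 (by omega)
  omega

/-- If all the neighbours of `x` in a piece `C` with at least three vertices were among `x` and
`u`, then moving `u` to `S` would split `C` into the two odd pieces `{x}` and `C \ {x, u}`. -/
lemma IsMaximal.exists_joins (h : IsMaximal M F S 𝒞) {C : Finset V} (hC : C ∈ 𝒞) (hC3 : 3 ≤ #C)
    {x u : V} (hx : x ∈ C) (hu : u ∈ C) (hxu : x ≠ u) :
    ∃ y ∈ C, y ≠ x ∧ y ≠ u ∧ ∃ e, M.Joins e x y := by
  obtain ⟨hf, hc, hmax⟩ := h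
  by_contra! hcon
  have huS : u ∉ S := Finset.disjoint_left.1 (hf.disj C hC) hu
  have h1 : M.IsOddFamily F (insert u S) (𝒞.erase C) := by
    refine (hf.subset (Finset.erase_subset _ _)).insert_right fun C' hC' huC' ↦ ?_
    rw [Finset.mem_erase] at hC'
    exact Finset.disjoint_left.1 (hf.pairwise hC'.2 hC hC'.1) huC' hu
  have hsep : ∀ C' ∈ 𝒞.erase C, Disjoint C C' := fun C' hC' ↦ by
    rw [Finset.mem_erase] at hC'
    exact hf.pairwise hC hC'.2 (Ne.symm hC'.1)
  have hxS : x ∉ S := Finset.disjoint_left.1 (hf.disj C hC) hx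
  obtain ⟨h2, h2c⟩ := h1.insert_left (D := {x}) (by simp)
    (by simp [hxu, hxS])
    (by
      intro x' hx' y hy e he hJ
      rw [Finset.mem_singleton] at hx' ⊢
      subst hx'
      rw [Finset.mem_insert, not_or] at hy
      by_contra hyx
      exact hcon y (hf.closed C hC _ hx y hy.2 e he hJ) hyx hy.1 e hJ)
    (fun C' hC' ↦ Finset.disjoint_of_subset_left (by simpa using hx) (hsep C' hC'))
  have hsub : (C.erase x).erase u ⊆ C :=
    (Finset.erase_subset _ _).trans (Finset.erase_subset _ _)
  have hcardC : #((C.erase x).erase u) = #C - 2 := by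
    rw [Finset.card_erase_of_mem (by simp [hu, hxu.symm]), Finset.card_erase_of_mem hx]
    omega
  obtain ⟨h3, h3c⟩ := h2.insert_left (D := (C.erase x).erase u)
    (by
      have := hf.odd C hC
      rw [Nat.odd_iff] at *
      omega)
    (by
      rw [Finset.disjoint_insert_right]
      exact ⟨by simp, Finset.disjoint_of_subset_left hsub (hf.disj C hC)⟩)
    (by
      intro z hz y hy e he hJ
      rw [Finset.mem_insert, not_or] at hy
      simp only [Finset.mem_erase] at hz ⊢
      refine ⟨hy.1, fun hyx ↦ ?_, hf.closed C hC _ hz.2.2 y hy.2 e he hJ⟩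
      subst hyx
      exact hcon z hz.2.2 hz.2.1 hz.1 e hJ.symm)
    (by
      intro C' hC'
      rcases Finset.mem_insert.1 hC' with rfl | hC'
      · simp
      · exact Finset.disjoint_of_subset_left hsub (hsep C' hC'))
  have hpos : #(𝒞.erase C) = #𝒞 - 1 := Finset.card_erase_of_mem hC
  have hpos' : 0 < #𝒞 := Finset.card_pos.2 ⟨C, hC⟩
  have h4 : #(insert u S) = #S + 1 := Finset.card_insert_of_notMem huS
  have := hmax _ _ h3 (by omega)
  omega

/-- Every vertex of a large piece of a maximal barrier sends at most one edge out of it. -/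
lemma IsMaximal.card_cut_le (hM : M.IsCubic) (h : IsMaximal M F S 𝒞) {C : Finset V} (hC : C ∈ 𝒞)
    (hC3 : 3 ≤ #C) : #(M.cut C) ≤ #C := by
  have h1 : #(M.cut C) = ∑ e ∈ M.cut C, M.ends C e := by
    rw [Finset.card_eq_sum_ones]
    refine Finset.sum_congr rfl fun e he ↦ ?_
    rw [M.mem_cut] at he
    unfold ends
    split_ifs <;> tauto
  rw [h1, Finset.sum_congr rfl fun e _ ↦ M.ends_eq_sum C e, Finset.sum_comm,
    Finset.card_eq_sum_ones]
  refine Finset.sum_le_sum fun x hx ↦ ?_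
  obtain ⟨u₀, hu₀, hu₀x⟩ : ∃ u ∈ C, u ≠ x := Finset.exists_mem_ne (by omega) x
  obtain ⟨y, hy, hyx, -, e, hJ⟩ := h.exists_joins hC hC3 hx hu₀ hu₀x.symm
  obtain ⟨z, hz, hzx, hzy, f, hJ'⟩ := h.exists_joins hC hC3 hx hy hyx.symm
  have hef : e ≠ f := by
    rintro rfl
    rcases hJ with ⟨a, b⟩ | ⟨a, b⟩ <;> rcases hJ' with ⟨c, d⟩ | ⟨c, d⟩ <;> subst_vars <;> tauto
  have h2 : ∑ g ∈ M.cut C, M.ends {x} g + ∑ g ∈ {e, f}, M.ends {x} g ≤ ∑ g, M.ends {x} g := by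
    rw [← Finset.sum_union]
    · exact Finset.sum_le_sum_of_subset (Finset.subset_univ _)
    · rw [Finset.disjoint_right]
      intro g hg
      rcases Finset.mem_insert.1 hg with rfl | hg
      · rw [hJ.mem_cut]; tauto
      · rw [Finset.mem_singleton.1 hg, hJ'.mem_cut]; tauto
  rw [hM x, Finset.sum_pair hef, hJ.ends_eq, hJ'.ends_eq] at h2
  simp at h2
  omega

/-- An edge outside `F` that leaves a piece ends in `S`; an edge of `F` leaves at most two
pieces. -/
lemma sum_card_cut_le (hM : M.IsCubic) (hf : M.IsOddFamily F S 𝒞) :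
    ∑ C ∈ 𝒞, #(M.cut C) ≤ 3 * #S + 2 * #F := by
  have hone : ∀ v : V, #{C ∈ 𝒞 | v ∈ C} ≤ 1 := by
    intro v
    rw [Finset.card_le_one]
    intro C hC C' hC'
    simp only [Finset.mem_filter] at hC hC'
    by_contra hne
    exact Finset.disjoint_left.1 (hf.pairwise hC.1 hC'.1 hne) hC.2 hC'.2
  have key : ∀ e, #{C ∈ 𝒞 | e ∈ M.cut C} ≤ M.ends S e + if e ∈ F then 2 else 0 := by
    intro e
    have hsub : ({C ∈ 𝒞 | e ∈ M.cut C} : Finset _) ⊆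
        {C ∈ 𝒞 | M.fst e ∈ C} ∪ {C ∈ 𝒞 | M.snd e ∈ C} := by
      intro C hC
      simp only [Finset.mem_filter, Finset.mem_union, M.mem_cut] at hC ⊢
      tauto
    by_cases he : e ∈ F
    · have := (Finset.card_le_card hsub).trans (Finset.card_union_le _ _)
      have := hone (M.fst e)
      have := hone (M.snd e)
      simp only [he, if_true]
      omega
    · simp only [he, if_false, add_zero]
      have hS : ∀ C ∈ 𝒞, ∀ x ∈ C, x ∉ S := fun C hC x hx ↦
        Finset.disjoint_left.1 (hf.disj C hC) hx
      by_cases h1 : M.fst e ∈ S <;> by_cases h2 : M.snd e ∈ S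
      · rw [Finset.card_eq_zero.2]
        · exact Nat.zero_le _
        rw [Finset.filter_eq_empty_iff]
        intro C hC
        rw [M.mem_cut]
        have := hS C hC
        tauto
      · refine (Finset.card_le_card (t := {C ∈ 𝒞 | M.snd e ∈ C}) ?_).trans ?_
        · intro C hC
          simp only [Finset.mem_filter, M.mem_cut] at hC ⊢
          have := hS C hC.1
          tauto
        · simpa [ends, h1, h2] using hone _
      · refine (Finset.card_le_card (t := {C ∈ 𝒞 | M.fst e ∈ C}) ?_).trans ?_
        · intro C hC
          simp only [Finset.mem_filter, M.mem_cut] at hC ⊢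
          have := hS C hC.1
          tauto
        · simpa [ends, h1, h2] using hone _
      · rw [Finset.card_eq_zero.2]
        · exact Nat.zero_le _
        rw [Finset.filter_eq_empty_iff]
        intro C hC
        rw [M.mem_cut]
        have h3 := fun hx ↦ hf.closed C hC _ hx _ h2 e he (M.joins_fst_snd e)
        have h4 := fun hx ↦ hf.closed C hC _ hx _ h1 e he (M.joins_fst_snd e).symm
        tauto
  calc ∑ C ∈ 𝒞, #(M.cut C) = ∑ C ∈ 𝒞, ∑ e, if e ∈ M.cut C then 1 else 0 := by simp
    _ = ∑ e, #{C ∈ 𝒞 | e ∈ M.cut C} := by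
        rw [Finset.sum_comm]
        exact Finset.sum_congr rfl fun e _ ↦ (Finset.card_filter _ _).symm
    _ ≤ ∑ e, (M.ends S e + if e ∈ F then 2 else 0) := Finset.sum_le_sum fun e _ ↦ key e
    _ = 3 * #S + 2 * #F := by
        rw [Finset.sum_add_distrib, hM.sum_ends]
        simp [mul_comm]

end IsOddFamily

lemma IsCubic.even_card (hM : M.IsCubic) : Even (Fintype.card V) := by
  have h := hM.two_mul_card_inner univ
  have h2 : #(M.cut univ) = 0 := by simp [cut]
  rw [h2, Finset.card_univ] at h
  rw [Nat.even_iff]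
  omega

/-- A vertex set of odd size is left by an odd number of edges, hence by at least three. -/
lemma IsCubic.three_le_card_cut (hM : M.IsCubic) {h : ℕ} (hK : M.CutBound h) (hh : 2 ≤ h)
    {C : Finset V} (hC : Odd #C) (hC' : Cᶜ.Nonempty) : 3 ≤ #(M.cut C) := by
  have h1 := hM.two_mul_card_inner C
  have h2 := hK C (Finset.card_pos.1 hC.pos) hC'
  rw [Nat.odd_iff] at hC
  omega

lemma IsCubic.sum_compl_ends (hM : M.IsCubic) (F : Finset E) (W : Finset V) :
    ∑ e ∈ F, M.ends W e + ∑ e ∈ Fᶜ, M.ends W e = 3 * #W := by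
  rw [Finset.sum_add_sum_compl, hM.sum_ends]

lemma cut_subset_touching (W : Finset V) : M.cut W ⊆ M.touching W := by
  intro e he
  rw [mem_cut] at he
  rw [mem_touching]
  tauto

variable {l : ℕ} {pv : Fin (l + 1) → V} {pe : Fin l → E}

namespace IsOddFamily

variable {S : Finset V} {𝒞 : Finset (Finset V)}

/-- A barrier of a path in which some piece is large is impossible: the rest of the graph would be
small, so its other pieces are single vertices, joined to `S` by too many edges for the set formed
by the path, `S` and these vertices to have a cut as large as its number of vertices requires. -/
lemma IsMaximal.card_lt_three (hM : M.IsCubic) (hK : M.CutBound (max (4 * l - 5) 2))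
    (hP : M.IsPath pv pe) (hl : 3 ≤ l) (hbig : 10 * l - 16 ≤ Fintype.card V)
    (h : IsMaximal M (univ.image pe) S 𝒞) {C : Finset V} (hC : C ∈ 𝒞) : #C < 3 := by
  by_contra! hC3
  have hrest := h.rest_eq_empty hM.even_card
  have hcutC := fun C' (hC' : C' ∈ 𝒞) hC3' ↦ h.card_cut_le hM (C := C') hC' hC3'
  obtain ⟨hf, hc, -⟩ := h
  set F := univ.image pe with hF
  set PV := univ.image pv with hPV
  have hFl : #F = l := hP.card_edges
  have hPVl : #PV = l + 1 := hP.card_verts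
  have hsum := hf.sum_card_cut_le hM
  have hsep : ∀ C₁ ∈ 𝒞, ∀ C₂ ∈ 𝒞, C₁ ≠ C₂ → Disjoint C₁ C₂ := fun C₁ h₁ C₂ h₂ hne ↦
    hf.pairwise h₁ h₂ hne
  have hcompl : ∀ C' ∈ 𝒞, C'ᶜ.Nonempty := by
    intro C' hC'
    obtain ⟨C₂, hC₂, hne⟩ := Finset.exists_mem_ne (by omega : 1 < #𝒞) C'
    obtain ⟨x, hx⟩ := Finset.card_pos.1 (hf.odd C₂ hC₂).pos
    exact ⟨x, by simpa using Finset.disjoint_left.1 (hsep _ hC₂ _ hC' hne) hx⟩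
  have h3 : ∀ C' ∈ 𝒞, 3 ≤ #(M.cut C') := fun C' hC' ↦
    hM.three_le_card_cut hK (le_max_right _ _) (hf.odd C' hC') (hcompl C' hC')
  have hle : ∀ C' ∈ 𝒞, #(M.cut C') + 3 * (#S + 1) ≤ 3 * #S + 2 * l := by
    intro C' hC'
    rw [← Finset.add_sum_erase _ _ hC'] at hsum
    have := Finset.card_nsmul_le_sum (𝒞.erase C') (fun C ↦ #(M.cut C)) 3
      fun C₂ hC₂ ↦ h3 C₂ (Finset.mem_of_mem_erase hC₂)
    rw [Finset.card_erase_of_mem hC', smul_eq_mul] at this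
    omega
  have hlarge : ∀ C' ∈ 𝒞, 3 ≤ #C' → #C'ᶜ + 2 ≤ 2 * l - 3 := by
    intro C' hC' hC3'
    have h4 := hcutC C' hC' hC3'
    have h5 := hle C' hC'
    have h6 := hK C' (Finset.card_pos.1 (by omega)) (hcompl C' hC')
    omega
  have hCc := hlarge C hC hC3
  have hone : ∀ C' ∈ 𝒞.erase C, #C' = 1 := by
    intro C' hC'
    rw [Finset.mem_erase] at hC'
    by_contra hne
    have hodd := hf.odd C' hC'.2
    have h4 : 3 ≤ #C' := by rw [Nat.odd_iff] at hodd; omega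
    have h5 := hlarge C' hC'.2 h4
    have h6 : #C' ≤ #Cᶜ := Finset.card_le_card fun x hx ↦ by
      simpa using Finset.disjoint_left.1 (hsep _ hC'.2 _ hC hC'.1) hx
    have h7 := Finset.card_add_card_compl C'
    omega
  set T := (𝒞.erase C).biUnion id with hT
  have hTcard : #T = #S + 1 := by
    rw [hT, Finset.card_biUnion (hf.subset (Finset.erase_subset _ _)).pairwise,
      Finset.sum_congr rfl (f := fun C' ↦ #(id C')) (g := fun _ ↦ 1) fun C' hC' ↦ hone C' hC']
    rw [Finset.sum_const, Finset.card_erase_of_mem hC, smul_eq_mul]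
    omega
  have hTS : Disjoint T S := by
    rw [Finset.disjoint_biUnion_left]
    exact fun C' hC' ↦ hf.disj C' (Finset.mem_of_mem_erase hC')
  have hTC : Disjoint T C := by
    rw [Finset.disjoint_biUnion_left]
    intro C' hC'
    rw [Finset.mem_erase] at hC'
    exact hsep _ hC'.2 _ hC hC'.1
  have hSC : Disjoint S C := (hf.disj C hC).symm
  have hcover : ∀ x, x ∈ S ∨ x ∈ T ∨ x ∈ C := by
    intro x
    by_contra! hcon
    have : x ∈ rest S 𝒞 := by
      refine mem_rest.2 ⟨hcon.1, fun C' hC' hx ↦ ?_⟩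
      by_cases hCC : C' = C
      · exact hcon.2.2 (hCC ▸ hx)
      · exact hcon.2.1 (Finset.mem_biUnion.2 ⟨C', Finset.mem_erase.2 ⟨hCC, hC'⟩, hx⟩)
    simp [hrest] at this
  -- an edge off the path with an end in `T` has its other end in `S`
  have hTedge : ∀ e ∉ F, ∀ x ∈ T, ∀ y, M.Joins e x y → y ∈ S := by
    intro e he x hx y hJ
    by_contra hy
    obtain ⟨C', hC', hxC'⟩ := Finset.mem_biUnion.1 hx
    have hC'' := Finset.mem_of_mem_erase hC'
    have hyC' := hf.closed C' hC'' x hxC' y hy e he hJ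
    have h4 := h3 C' hC''
    have h5 := hM.two_mul_card_inner C'
    have h6 : 0 < #(M.inner C') := Finset.card_pos.2 ⟨e, hJ.mem_inner.2 ⟨hxC', hyC'⟩⟩
    rw [hone C' hC'] at h5
    omega
  set a := #(T ∩ PV) with ha
  set c := #(C ∩ PV) with hcdef
  have hac : a + c ≤ l + 1 := by
    rw [← hPVl, ha, hcdef, ← Finset.card_union_of_disjoint]
    · exact Finset.card_le_card (Finset.union_subset Finset.inter_subset_right
        Finset.inter_subset_right)
    · exact Finset.disjoint_of_subset_left Finset.inter_subset_left
        (Finset.disjoint_of_subset_right Finset.inter_subset_left hTC)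
  have haT : a ≤ #T := Finset.card_le_card Finset.inter_subset_left
  have hsumT := hM.sum_compl_ends F T
  have hsumS := hM.sum_compl_ends F S
  have hsumC := hM.sum_compl_ends F (C ∩ PV)
  have hPT := hP.sum_ends_le T
  have hPC := hP.le_sum_ends (C ∩ PV)
  rw [← hPV, ← hF] at hPT hPC
  rw [Finset.inter_assoc, Finset.inter_self] at hPC
  set Z := S ∪ T ∪ (C ∩ PV) with hZ
  have hZcard : #Z = #S + #T + c := by
    rw [hZ, Finset.card_union_of_disjoint, Finset.card_union_of_disjoint hTS.symm]
    rw [Finset.disjoint_union_left]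
    exact ⟨Finset.disjoint_of_subset_right Finset.inter_subset_left hSC,
      Finset.disjoint_of_subset_right Finset.inter_subset_left hTC⟩
  have hFZ : ∀ e ∈ F, e ∉ M.cut Z := by
    have hsub : PV ⊆ Z := fun x hx ↦ by
      rcases hcover x with h | h | h <;> simp [hZ, h, hx]
    intro e he
    have h4 := hP.edges_subset_inner he
    rw [M.mem_inner] at h4
    rw [M.mem_cut]
    have h5 := hsub h4.1
    have h6 := hsub h4.2
    tauto
  have hpoint : ∀ e ∈ Fᶜ, (if e ∈ M.cut Z then 1 else 0) + M.ends T e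
      ≤ M.ends S e + M.ends (C ∩ PV) e := by
    intro e he
    rw [Finset.mem_compl] at he
    have h6 : ∀ x ∈ T, x ∉ S := fun x hx ↦ Finset.disjoint_left.1 hTS hx
    by_cases hT' : e ∈ M.touching T
    · obtain ⟨x, hx, y, hJ⟩ := M.exists_joins_of_mem_touching hT'
      have hy := hTedge e he x hx y hJ
      have hyT : y ∉ T := fun h ↦ h6 y h hy
      have hcut : e ∉ M.cut Z := by
        rw [hJ.mem_cut]
        simp [hZ, hx, hy]
      rw [hJ.ends_eq, hJ.ends_eq S, if_neg hcut, if_pos hx, if_neg hyT, if_pos hy]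
      omega
    · have h7 : M.ends T e = 0 := by
        by_contra hne
        exact hT' (M.ends_pos_iff.1 (Nat.pos_of_ne_zero hne))
      rw [h7]
      split_ifs with hcut
      · obtain ⟨x, hx, y, -, hJ⟩ := M.exists_joins_of_mem_cut hcut
        rw [hJ.mem_touching] at hT'
        simp only [hZ, Finset.mem_union] at hx
        rcases hx with (hx | hx) | hx
        · have := M.ends_pos_iff.2 (hJ.mem_touching.2 (Or.inl hx))
          omega
        · exact absurd (Or.inl hx) hT'
        · have := M.ends_pos_iff.2 (hJ.mem_touching.2 (Or.inl hx))
          omega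
      · exact Nat.zero_le _
  have hZsum := Finset.sum_le_sum hpoint
  rw [Finset.sum_add_distrib, Finset.sum_add_distrib] at hZsum
  have hZcut : ∑ e ∈ Fᶜ, (if e ∈ M.cut Z then 1 else 0) = #(M.cut Z) := by
    rw [← Finset.card_filter]
    congr 1
    ext e
    simp only [Finset.mem_filter, Finset.mem_compl]
    exact ⟨fun h ↦ h.2, fun h ↦ ⟨fun he ↦ hFZ e he h, h⟩⟩
  have hTsum : ∑ e ∈ Fᶜ, M.ends T e ≤ ∑ e ∈ Fᶜ, M.ends S e := by
    refine Finset.sum_le_sum fun e he ↦ ?_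
    rw [Finset.mem_compl] at he
    have h4 := fun hx ↦ hTedge e he _ hx _ (M.joins_fst_snd e)
    have h5 := fun hx ↦ hTedge e he _ hx _ (M.joins_fst_snd e).symm
    unfold ends
    split_ifs <;> first | omega | (exfalso; tauto)
  have hCcard : #Cᶜ = #S + #T := by
    rw [← Finset.card_union_of_disjoint hTS.symm]
    congr 1
    ext x
    simp only [Finset.mem_compl, Finset.mem_union]
    constructor
    · intro hx
      have := hcover x
      tauto
    · rintro (hx | hx)
      · exact Finset.disjoint_left.1 hSC hx
      · exact Finset.disjoint_left.1 hTC hx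
  have hZV := Finset.card_add_card_compl Z
  have := hK Z (Finset.card_pos.1 (by omega)) (Finset.card_pos.1 (by omega))
  omega

end IsOddFamily

/-- If no perfect matching of a cubic graph avoids a path with `l` edges, then the graph is
bipartite up to edges of the path inside one class `A` and edges inside the other one, and the
former exceed the latter by three. The hypothesis on the number of vertices only matters
for `l ≥ 3`. -/
lemma exists_card_inner_eq (hM : M.IsCubic) (hK : M.CutBound (max (4 * l - 5) 2))
    (hP : M.IsPath pv pe) (hbig : 3 ≤ l → 10 * l - 16 ≤ Fintype.card V)
    (h : ¬∃ N : (M.avoid (univ.image pe)).Subgraph, N.IsPerfectMatching) :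
    3 ≤ l ∧ ∃ A : Finset V, M.inner A ⊆ univ.image pe ∧ #(M.inner A) = #(M.inner Aᶜ) + 3 := by
  obtain ⟨S₀, 𝒞₀, hf₀, hlt⟩ := exists_isOddFamily_of_not_isPerfectMatching _ h
  obtain ⟨S, 𝒞, hmax⟩ := hf₀.exists_isMaximal hlt hM.even_card
  have hrest := hmax.rest_eq_empty hM.even_card
  have hsum := hmax.1.sum_card_cut_le hM
  rw [hP.card_edges] at hsum
  have hsep : ∀ C₁ ∈ 𝒞, ∀ C₂ ∈ 𝒞, C₁ ≠ C₂ → Disjoint C₁ C₂ := fun C₁ h₁ C₂ h₂ hne ↦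
    hmax.1.pairwise h₁ h₂ hne
  have hc := hmax.2.1
  have h3 : ∀ C ∈ 𝒞, 3 ≤ #(M.cut C) := by
    intro C hC
    refine hM.three_le_card_cut hK (le_max_right _ _) (hmax.1.odd C hC) ?_
    obtain ⟨C₂, hC₂, hne⟩ := Finset.exists_mem_ne (by omega : 1 < #𝒞) C
    obtain ⟨x, hx⟩ := Finset.card_pos.1 (hmax.1.odd C₂ hC₂).pos
    exact ⟨x, by simpa using Finset.disjoint_left.1 (hsep _ hC₂ _ hC hne) hx⟩
  have hl : 3 ≤ l := by
    have := Finset.card_nsmul_le_sum 𝒞 (fun C ↦ #(M.cut C)) 3 h3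
    rw [smul_eq_mul] at this
    omega
  have hone : ∀ C ∈ 𝒞, #C = 1 := by
    intro C hC
    have h4 := hmax.card_lt_three hM hK hP hl (hbig hl) hC
    have h5 := hmax.1.odd C hC
    rw [Nat.odd_iff] at h5
    omega
  refine ⟨hl, 𝒞.biUnion id, ?_, ?_⟩
  · intro e he
    rw [mem_inner] at he
    by_contra hF
    obtain ⟨C, hC, hx⟩ := Finset.mem_biUnion.1 he.1
    obtain ⟨C', hC', hy⟩ := Finset.mem_biUnion.1 he.2
    have h4 := hmax.1.closed C hC _ hx _ (Finset.disjoint_left.1 (hmax.1.disj C' hC') hy) e hF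
      (M.joins_fst_snd e)
    have h5 := hM.two_mul_card_inner C
    have h6 : 0 < #(M.inner C) := Finset.card_pos.2 ⟨e, M.mem_inner.2 ⟨hx, h4⟩⟩
    have h7 := h3 C hC
    rw [hone C hC] at h5
    omega
  · have hA : #(𝒞.biUnion id) = #S + 2 := by
      rw [Finset.card_biUnion hmax.1.pairwise,
        Finset.sum_congr rfl (f := fun C ↦ #(id C)) (g := fun _ ↦ 1) fun C hC ↦ hone C hC]
      simpa using hc
    have h4 := hmax.1.card_add
    rw [hrest, Finset.card_empty] at h4
    have h5 := hM.two_mul_card_inner (𝒞.biUnion id)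
    have h6 := hM.two_mul_card_inner (𝒞.biUnion id)ᶜ
    rw [mem_cut_compl] at h6
    have h7 := Finset.card_add_card_compl (𝒞.biUnion id)
    omega

/-! ### Comparing the barriers of two paths -/

/-- The vertices at distance at most `r` from the vertex set `B`. -/
noncomputable def ball (M : Multigraph V E) (B : Finset V) : ℕ → Finset V
  | 0 => B
  | r + 1 => ball M B r ∪ ({y | ∃ x ∈ ball M B r, ∃ e, M.Joins e x y} : Finset V)

lemma ball_mono (B : Finset V) : Monotone (M.ball B) :=
  monotone_nat_of_le_succ fun _ ↦ Finset.subset_union_left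

lemma mem_ball_succ {B : Finset V} {r : ℕ} {x y : V} {e : E} (hx : x ∈ M.ball B r)
    (hJ : M.Joins e x y) : y ∈ M.ball B (r + 1) := by
  simp only [ball, Finset.mem_union, Finset.mem_filter, Finset.mem_univ, true_and]
  exact Or.inr ⟨x, hx, e, hJ⟩

/-- The vertices that can be reached from `P` inside `X` form a set `Z` such that every vertex of
`Z` is at distance at most `#(Z \ P)` from `P`. -/
lemma exists_closed_region (M : Multigraph V E) (X P : Finset V) :
    ∃ Z : Finset V, P ⊆ Z ∧ Z ⊆ X ∪ P ∧ (∀ z ∈ Z, z ∉ P → ∃ e ∈ M.inner Z, e ∈ M.touching {z}) ∧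
      Z ⊆ M.ball P #(Z \ P) ∧ ∀ z ∈ Z, ∀ e y, M.Joins e z y → y ∈ X → y ∈ Z := by
  let 𝓕 : Finset (Finset V) := {Z | P ⊆ Z ∧ Z ⊆ X ∪ P ∧
    (∀ z ∈ Z, z ∉ P → ∃ e ∈ M.inner Z, e ∈ M.touching {z}) ∧ Z ⊆ M.ball P #(Z \ P)}
  have hne : 𝓕.Nonempty := by
    refine ⟨P, ?_⟩
    simp only [𝓕, Finset.mem_filter, Finset.mem_univ, true_and]
    exact ⟨Finset.Subset.refl _, Finset.subset_union_right, fun z hz hz' ↦ absurd hz hz',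
      M.ball_mono P (Nat.zero_le _)⟩
  obtain ⟨Z, hZ, hmax⟩ := Finset.exists_max_image 𝓕 Finset.card hne
  simp only [𝓕, Finset.mem_filter, Finset.mem_univ, true_and] at hZ hmax
  obtain ⟨h1, h2, h3, h4⟩ := hZ
  refine ⟨Z, h1, h2, h3, h4, fun z hz e y hJ hy ↦ ?_⟩
  by_contra hyZ
  have hin : ∀ e, e ∈ M.inner Z → e ∈ M.inner (insert y Z) := by
    intro e he
    rw [mem_inner] at he ⊢
    exact ⟨Finset.mem_insert_of_mem he.1, Finset.mem_insert_of_mem he.2⟩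
  have hcard : #(insert y Z \ P) = #(Z \ P) + 1 := by
    rw [Finset.insert_sdiff_of_notMem _ (fun h ↦ hyZ (h1 h)), Finset.card_insert_of_notMem]
    exact fun h ↦ hyZ (Finset.mem_sdiff.1 h).1
  have := hmax (insert y Z) ⟨h1.trans (Finset.subset_insert _ _), ?_, ?_, ?_⟩
  · rw [Finset.card_insert_of_notMem hyZ] at this
    omega
  · exact Finset.insert_subset (Finset.mem_union_left _ hy) h2
  · intro w hw hwP
    rcases Finset.mem_insert.1 hw with rfl | hw
    · exact ⟨e, hJ.mem_inner.2 ⟨Finset.mem_insert_of_mem hz, Finset.mem_insert_self _ _⟩,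
        hJ.mem_touching.2 (Or.inr (Finset.mem_singleton_self _))⟩
    · obtain ⟨f, hf, hf'⟩ := h3 w hw hwP
      exact ⟨f, hin f hf, hf'⟩
  · rw [hcard]
    refine Finset.insert_subset (mem_ball_succ (h4 hz) hJ) ?_
    exact h4.trans (M.ball_mono P (Nat.le_succ _))

lemma card_filter_touching_le (F : Finset E) (W : Finset V) :
    #{e ∈ F | e ∈ M.touching W} ≤ ∑ e ∈ F, M.ends W e := by
  rw [Finset.card_filter]
  refine Finset.sum_le_sum fun e _ ↦ ?_
  split_ifs with h
  · exact M.ends_pos_iff.2 h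
  · exact Nat.zero_le _

/-- If every vertex of `W` is the end of an edge inside `Z`, then at most `2 #W` edges leave `Z`
from `W`. -/
lemma IsCubic.sum_cut_ends_le (hM : M.IsCubic) {Z W : Finset V}
    (h : ∀ z ∈ W, ∃ e ∈ M.inner Z, e ∈ M.touching {z}) :
    ∑ e ∈ M.cut Z, M.ends W e ≤ 2 * #W := by
  rw [Finset.sum_congr rfl fun e _ ↦ M.ends_eq_sum W e, Finset.sum_comm, mul_comm, ← smul_eq_mul]
  refine Finset.sum_le_card_nsmul _ _ _ fun x hx ↦ ?_
  obtain ⟨e, he, he'⟩ := h x hx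
  have hcut : e ∉ M.cut Z := by
    rw [mem_inner] at he
    rw [mem_cut]
    tauto
  have h1 : ∑ g ∈ insert e (M.cut Z), M.ends {x} g ≤ ∑ g, M.ends {x} g :=
    Finset.sum_le_sum_of_subset (Finset.subset_univ _)
  rw [Finset.sum_insert hcut, hM x] at h1
  have := M.ends_pos_iff.2 he'
  omega

lemma IsPath.exists_touching (hP : M.IsPath pv pe) (hl : 1 ≤ l) {z : V} (hz : z ∈ univ.image pv) :
    ∃ e ∈ M.inner (univ.image pv), e ∈ M.touching {z} := by
  obtain ⟨i, -, rfl⟩ := Finset.mem_image.1 hz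
  have hmem : ∀ j, pe j ∈ M.inner (univ.image pv) := fun j ↦
    hP.edges_subset_inner (Finset.mem_image_of_mem _ (Finset.mem_univ _))
  rcases Fin.eq_castSucc_or_eq_last i with ⟨j, rfl⟩ | rfl
  · exact ⟨pe j, hmem j, (hP.joins j).mem_touching.2 (by simp)⟩
  · refine ⟨pe ⟨l - 1, by omega⟩, hmem _, (hP.joins _).mem_touching.2 (Or.inr ?_)⟩
    rw [Finset.mem_singleton]
    congr 1
    ext
    simp
    omega

/-- The situation around a path with vertices `PV` and edges `PE` and a barrier whose independent
side is `B`, compared with the independent side `A` of the barrier of a far away path: `Z` is a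
neighbourhood of the path that can be left only through vertices of `PV` or to the outside of `X`,
and it touches no edge inside `A`. -/
structure IsRegion (M : Multigraph V E) (A B X PV : Finset V) (PE : Finset E) (Z : Finset V) :
    Prop where
  subset_left : PV ⊆ Z
  subset_right : Z ⊆ X ∪ PV
  closed : ∀ z ∈ Z, ∀ e y, M.Joins e z y → y ∈ X → y ∈ Z
  avoid : ∀ e ∈ M.inner A, e ∉ M.touching Z
  inner_subset : M.inner B ⊆ PE
  edges_subset : PE ⊆ M.inner PV

/-- The edges that leave `Z` from a vertex in `D` and have no end in `A`. -/
noncomputable def leaving (M : Multigraph V E) (Z D A : Finset V) : Finset E :=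
  {e ∈ M.cut Z | e ∈ M.touching D ∧ e ∈ M.inner Aᶜ}

lemma leaving_subset_inner (Z D A : Finset V) : M.leaving Z D A ⊆ M.inner Aᶜ := fun _ he ↦
  (Finset.mem_filter.1 he).2.2

lemma leaving_subset (Z D A : Finset V) : M.leaving Z D A ⊆ M.inner Aᶜ ∩ M.touching Z := by
  intro e he
  have := Finset.mem_filter.1 he
  exact Finset.mem_inter.2 ⟨this.2.2, cut_subset_touching _ this.1⟩

namespace IsRegion

variable {A B X Z : Finset V}

lemma not_mem_and_mem {PV : Finset V} {PE : Finset E} (h : M.IsRegion A B X PV PE Z) {z y : V}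
    {e : E} (hz : z ∈ Z) (hJ : M.Joins e z y) : ¬(z ∈ A ∧ y ∈ A) := fun hc ↦
  h.avoid e (hJ.mem_inner.2 hc) (hJ.mem_touching.2 (Or.inl hz))

lemma edge_not_mem_cut {PV : Finset V} {PE : Finset E} (h : M.IsRegion A B X PV PE Z) {e : E}
    (he : e ∈ PE) : e ∉ M.cut Z := by
  have h1 := h.edges_subset he
  rw [mem_inner] at h1
  rw [mem_cut]
  have := h.subset_left h1.1
  have := h.subset_left h1.2
  tauto

/-- An edge that leaves the region from a vertex of `X` is monochromatic for exactly one of the two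
colourings `A` and `B`, and therefore lies in the complement of `A` or of `B`. -/
lemma card_cut_le (hM : M.IsCubic) (hP : M.IsPath pv pe)
    (h : M.IsRegion A B X (univ.image pv) (univ.image pe) Z)
    (hX : (∀ v, v ∈ X ↔ ¬(v ∈ A ↔ v ∈ B)) ∨ ∀ v, v ∈ X ↔ (v ∈ A ↔ v ∈ B)) :
    #(M.cut Z) ≤ #(M.leaving Z (Z ∩ X) A) + #(M.leaving Z (Z ∩ X) B) + (#(Z \ X) + 2) := by
  set PE := univ.image pe with hPE
  have hsub : M.cut Z ⊆ M.leaving Z (Z ∩ X) A ∪ M.leaving Z (Z ∩ X) B ∪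
      {e ∈ PEᶜ | e ∈ M.touching (Z \ X)} := by
    intro e he
    obtain ⟨z, hz, y, hy, hJ⟩ := M.exists_joins_of_mem_cut he
    have hPEe : e ∉ PE := fun hm ↦ h.edge_not_mem_cut hm he
    have hyX : y ∉ X := fun hyX ↦ hy (h.closed z hz e y hJ hyX)
    have hnA := h.not_mem_and_mem hz hJ
    have hnB : ¬(z ∈ B ∧ y ∈ B) := fun hc ↦ hPEe (h.inner_subset (hJ.mem_inner.2 hc))
    simp only [leaving, Finset.mem_union, Finset.mem_filter, Finset.mem_compl, he, true_and,
      hJ.mem_touching, hJ.mem_inner, Finset.mem_inter, Finset.mem_sdiff, hPEe, hz, hy,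
      not_false_eq_true, false_and, or_false]
    by_cases hzX : z ∈ X
    · rcases hX with hX | hX <;> rw [hX] at hyX <;> have := (hX z).1 hzX <;> tauto
    · tauto
  have h1 := (Finset.card_le_card hsub).trans ((Finset.card_union_le _ _).trans
    (Nat.add_le_add_right (Finset.card_union_le _ _) _))
  have h2 : #{e ∈ PEᶜ | e ∈ M.touching (Z \ X)} ≤ #(Z \ X) + 2 := by
    refine (card_filter_touching_le _ _).trans ?_
    have h3 := hM.sum_compl_ends PE (Z \ X)
    have h4 := hP.le_sum_ends (Z \ X)
    rw [Finset.inter_eq_left.2, ← hPE] at h4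
    · omega
    · intro x hx
      rw [Finset.mem_sdiff] at hx
      have := h.subset_right hx.1
      rw [Finset.mem_union] at this
      tauto
  omega

/-- The case in which the two colourings agree outside `X`. Each edge of the path inside `B` has an
end in `D ∩ B`, where `D = Z ∩ X`. -/
lemma card_inner_le_of_agree (hM : M.IsCubic) (hP : M.IsPath pv pe) (hl : 1 ≤ l)
    (h : M.IsRegion A B X (univ.image pv) (univ.image pe) Z)
    (hX : ∀ v, v ∈ X ↔ ¬(v ∈ A ↔ v ∈ B))
    (hZ : ∀ z ∈ Z, z ∉ univ.image pv → ∃ e ∈ M.inner Z, e ∈ M.touching {z})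
    (hD : #(Z ∩ X) ≤ #(M.leaving Z (Z ∩ X) A) + #(M.leaving Z (Z ∩ X) B)) :
    #(M.inner B) ≤ 2 * #(M.inner Aᶜ ∩ M.touching Z) + #(M.inner Bᶜ ∩ M.touching Z) := by
  set D := Z ∩ X with hDdef
  have hcard := Finset.card_inter_add_card_sdiff D B
  have h1 : #(M.inner B) ≤ 2 * #(D ∩ B) := by
    have hsub : M.inner B ⊆ {e ∈ univ.image pe | e ∈ M.touching (D ∩ B)} := by
      intro e he
      have hePE := h.inner_subset he
      have hePV := h.edges_subset hePE
      have hA : e ∉ M.inner A := fun he' ↦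
        h.avoid e he' (M.mem_touching.2 (Or.inl (h.subset_left (M.mem_inner.1 hePV).1)))
      rw [mem_inner] at he hePV hA
      have h2 := h.subset_left hePV.1
      have h3 := h.subset_left hePV.2
      simp only [Finset.mem_filter, hePE, true_and, mem_touching, hDdef, Finset.mem_inter, hX]
      tauto
    refine (Finset.card_le_card hsub).trans ((card_filter_touching_le _ _).trans ?_)
    refine (hP.sum_ends_le _).trans ?_
    have := Finset.card_le_card (Finset.inter_subset_left : D ∩ B ∩ univ.image pv ⊆ D ∩ B)
    omega
  have h2 : #(M.leaving Z D B) ≤ 2 * #(D \ B) := by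
    have hsub : M.leaving Z D B ⊆ {e ∈ M.cut Z | e ∈ M.touching (D \ B)} := by
      intro e he
      simp only [leaving, Finset.mem_filter, mem_touching, mem_inner, Finset.mem_compl,
        Finset.mem_sdiff] at he ⊢
      tauto
    refine (Finset.card_le_card hsub).trans ((card_filter_touching_le _ _).trans ?_)
    refine hM.sum_cut_ends_le fun z hz ↦ ?_
    have hzZ : z ∈ Z := (Finset.mem_inter.1 (Finset.mem_sdiff.1 hz).1).1
    by_cases hzP : z ∈ univ.image pv
    · obtain ⟨e, he, he'⟩ := hP.exists_touching hl hzP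
      refine ⟨e, ?_, he'⟩
      rw [mem_inner] at he ⊢
      exact ⟨h.subset_left he.1, h.subset_left he.2⟩
    · exact hZ z hzZ hzP
  have h3 := Finset.card_le_card (M.leaving_subset Z D A)
  have h4 := Finset.card_le_card (M.leaving_subset Z D B)
  omega

/-- If the two colourings are opposite outside `X`, an edge at `D ∩ B` that is not inside `B` leads
to `D \ B`. -/
lemma ends_add_leaving_le {PV : Finset V} {PE : Finset E} (h : M.IsRegion A B X PV PE Z)
    (hX : ∀ v, v ∈ X ↔ (v ∈ A ↔ v ∈ B)) (e : E) :
    M.ends (Z ∩ X ∩ B) e + ((if e ∈ M.leaving Z (Z ∩ X) A then 1 else 0) +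
      if e ∈ M.leaving Z (Z ∩ X) B then 1 else 0) ≤
    M.ends ((Z ∩ X) \ B) e + if e ∈ M.inner B ∧ e ∈ M.touching (Z ∩ X ∩ B) then 1 else 0 := by
  generalize hDdef : Z ∩ X = D
  by_cases hT : e ∈ M.touching (D ∩ B)
  · obtain ⟨z, hz, y, hJ⟩ := M.exists_joins_of_mem_touching hT
    obtain ⟨hzD, hzB⟩ := Finset.mem_inter.1 hz
    obtain ⟨hzZ, hzX⟩ := Finset.mem_inter.1 (hDdef ▸ hzD)
    have hzA := ((hX z).1 hzX).2 hzB
    have hyA : y ∉ A := fun hy ↦ h.not_mem_and_mem hzZ hJ ⟨hzA, hy⟩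
    have hl1 : e ∉ M.leaving Z D A := fun he ↦ by
      have := M.leaving_subset_inner Z D A he
      rw [hJ.mem_inner, Finset.mem_compl] at this
      exact this.1 hzA
    have hl2 : e ∉ M.leaving Z D B := fun he ↦ by
      have := M.leaving_subset_inner Z D B he
      rw [hJ.mem_inner, Finset.mem_compl] at this
      exact this.1 hzB
    rw [if_neg hl1, if_neg hl2, hJ.ends_eq, hJ.ends_eq, if_pos hz]
    by_cases hyB : y ∈ B
    · have hyD : y ∉ D := fun hy ↦ hyA (((hX y).1 (Finset.mem_inter.1 (hDdef ▸ hy)).2).2 hyB)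
      have hQe : e ∈ M.inner B := hJ.mem_inner.2 ⟨hzB, hyB⟩
      simp [hyD, hQe, hT]
    · have hyX : y ∈ X := (hX y).2 (by tauto)
      have hyD : y ∈ D := hDdef ▸ Finset.mem_inter.2 ⟨h.closed z hzZ e y hJ hyX, hyX⟩
      simp [hyD, hyB, hzB]
  · have h0 : M.ends (D ∩ B) e = 0 := by
      by_contra hne
      exact hT (M.ends_pos_iff.1 (Nat.pos_of_ne_zero hne))
    have hnot : ¬(e ∈ M.leaving Z D A ∧ e ∈ M.leaving Z D B) := by
      rintro ⟨ha, hb⟩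
      obtain ⟨z, hz, y, hy, hJ⟩ := M.exists_joins_of_mem_cut (Finset.mem_filter.1 ha).1
      have h1 := hJ.mem_inner.1 (M.leaving_subset_inner Z D A ha)
      have h2 := hJ.mem_inner.1 (M.leaving_subset_inner Z D B hb)
      simp only [Finset.mem_compl] at h1 h2
      exact hy (h.closed z hz e y hJ ((hX y).2 (by tauto)))
    have hpos : e ∈ M.leaving Z D A ∨ e ∈ M.leaving Z D B → 0 < M.ends (D \ B) e := by
      intro he
      rw [ends_pos_iff]
      have : e ∈ M.touching D := by
        rcases he with he | he <;> exact (Finset.mem_filter.1 he).2.1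
      simp only [mem_touching, Finset.mem_inter, Finset.mem_sdiff] at this hT ⊢
      tauto
    rw [h0]
    by_cases h1 : e ∈ M.leaving Z D A
    · rw [if_pos h1, if_neg fun h2 ↦ hnot ⟨h1, h2⟩]
      have := hpos (Or.inl h1)
      omega
    · rw [if_neg h1]
      by_cases h2 : e ∈ M.leaving Z D B
      · rw [if_pos h2]
        have := hpos (Or.inr h2)
        omega
      · rw [if_neg h2]
        omega

/-- The case in which the two colourings are opposite outside `X`. No edge leaves the region from
`D ∩ B`, where `D = Z ∩ X`, and all but the path edges at `D ∩ B` lead to `D \ B`. -/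
lemma card_inner_le_of_opposite (hM : M.IsCubic) (hP : M.IsPath pv pe)
    (h : M.IsRegion A B X (univ.image pv) (univ.image pe) Z)
    (hX : ∀ v, v ∈ X ↔ (v ∈ A ↔ v ∈ B))
    (hD : #(Z ∩ X) ≤ #(M.leaving Z (Z ∩ X) A) + #(M.leaving Z (Z ∩ X) B)) :
    #(M.inner B) ≤ 2 * #(M.inner Aᶜ ∩ M.touching Z) + #(M.inner Bᶜ ∩ M.touching Z) := by
  set D := Z ∩ X with hDdef
  have hcard := Finset.card_inter_add_card_sdiff D B
  set Q := {e ∈ M.inner B | e ∈ M.touching (D ∩ B)} with hQ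
  have hQle : #Q ≤ 2 * #(D ∩ B) := by
    refine (Finset.card_le_card (Finset.filter_subset_filter _ h.inner_subset)).trans ?_
    refine (card_filter_touching_le _ _).trans ((hP.sum_ends_le _).trans ?_)
    have := Finset.card_le_card (Finset.inter_subset_left : D ∩ B ∩ univ.image pv ⊆ D ∩ B)
    omega
  have hN : #(M.inner B \ Q) + #(M.leaving Z D A) ≤ #(M.inner Aᶜ ∩ M.touching Z) := by
    rw [← Finset.card_union_of_disjoint]
    · refine Finset.card_le_card (Finset.union_subset ?_ (M.leaving_subset Z D A))
      intro e he
      rw [Finset.mem_sdiff, hQ, Finset.mem_filter] at he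
      have hePV := h.edges_subset (h.inner_subset he.1)
      have ht : e ∈ M.touching Z := M.mem_touching.2 (Or.inl (h.subset_left (M.mem_inner.1 hePV).1))
      rw [mem_inner] at hePV
      have h2 := h.subset_left hePV.1
      have h3 := h.subset_left hePV.2
      rw [Finset.mem_inter]
      refine ⟨?_, ht⟩
      simp only [mem_touching, mem_inner, hDdef, Finset.mem_inter, hX, Finset.mem_compl] at he ⊢
      tauto
    · rw [Finset.disjoint_left]
      intro e he he'
      exact h.edge_not_mem_cut (h.inner_subset (Finset.mem_sdiff.1 he).1)
        (Finset.mem_filter.1 he').1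
  have hpoint : ∀ e, M.ends (D ∩ B) e + ((if e ∈ M.leaving Z D A then 1 else 0) +
      if e ∈ M.leaving Z D B then 1 else 0) ≤ M.ends (D \ B) e + if e ∈ Q then 1 else 0 := by
    intro e
    simpa only [hQ, Finset.mem_filter] using h.ends_add_leaving_le hX e
  have hsum := Finset.sum_le_sum fun e (_ : e ∈ univ) ↦ hpoint e
  simp only [Finset.sum_add_distrib, hM.sum_ends, ← Finset.card_filter, Finset.filter_univ_mem]
    at hsum
  have h3 : #(M.inner B \ Q) + #Q = #(M.inner B) :=
    Finset.card_sdiff_add_card_eq_card (Finset.filter_subset _ _)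
  have h4 := Finset.card_le_card (M.leaving_subset Z D B)
  omega

end IsRegion

/-- The local estimate. Let `A` and `B` be the independent sides of the barriers of two far away
paths, the second of which is `pv`. Close to that path, the edges inside the complement of `A`,
counted twice, and those inside the complement of `B` are at least as many as the edges
inside `B`. -/
lemma card_inner_le_of_far (hM : M.IsCubic) (hK : M.CutBound (max (4 * l - 5) 2))
    (hP : M.IsPath pv pe) (hl : 3 ≤ l) (hbig : 10 * l - 16 ≤ Fintype.card V) {A B PV : Finset V}
    (hA : M.inner A ⊆ M.inner PV) (hB : M.inner B ⊆ univ.image pe)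
    (hAcard : #(M.inner A) = #(M.inner Aᶜ) + 3) (hBcard : #(M.inner B) = #(M.inner Bᶜ) + 3)
    (hAl : #(M.inner A) ≤ l) (hdist : Disjoint (M.ball (univ.image pv) (4 * l - 8)) PV) :
    #(M.inner B) ≤ 2 * #(M.inner Aᶜ ∩ M.touching (M.ball (univ.image pv) (2 * l - 6))) +
      #(M.inner Bᶜ ∩ M.touching (M.ball (univ.image pv) (2 * l - 6))) := by
  have hBl : #(M.inner B) ≤ l := (Finset.card_le_card hB).trans hP.card_edges.le
  obtain ⟨X, hX, hXcard⟩ : ∃ X : Finset V,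
      ((∀ v, v ∈ X ↔ ¬(v ∈ A ↔ v ∈ B)) ∨ ∀ v, v ∈ X ↔ (v ∈ A ↔ v ∈ B)) ∧ #X ≤ 4 * l - 8 := by
    set Y : Finset V := {v | v ∈ A ↔ v ∈ B} with hY
    have hmem : ∀ v, v ∈ Y ↔ (v ∈ A ↔ v ∈ B) := by simp [hY]
    have hcut : #(M.cut Y) ≤ 4 * l - 6 := by
      have hsub : M.cut Y ⊆ (M.inner A ∪ M.inner Aᶜ) ∪ (M.inner B ∪ M.inner Bᶜ) := by
        intro e he
        simp only [mem_cut, hmem, Finset.mem_union, mem_inner, Finset.mem_compl] at he ⊢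
        tauto
      have h1 := (Finset.card_le_card hsub).trans (Finset.card_union_le _ _)
      have h2 := Finset.card_union_le (M.inner A) (M.inner Aᶜ)
      have h3 := Finset.card_union_le (M.inner B) (M.inner Bᶜ)
      omega
    have hsmall : #Y ≤ 4 * l - 8 ∨ #Yᶜ ≤ 4 * l - 8 := by
      rcases Finset.eq_empty_or_nonempty Y with h0 | h0
      · simp [h0]
      rcases Finset.eq_empty_or_nonempty Yᶜ with h1 | h1
      · simp [h1]
      have := hK Y h0 h1
      omega
    rcases hsmall with h1 | h1
    · exact ⟨Y, Or.inr hmem, h1⟩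
    · exact ⟨Yᶜ, Or.inl fun v ↦ by rw [Finset.mem_compl, hmem], h1⟩
  obtain ⟨Z, h1, h2, h3, h4, h5⟩ := M.exists_closed_region X (univ.image pv)
  have hZX : Z \ univ.image pv ⊆ X := by
    intro x hx
    rw [Finset.mem_sdiff] at hx
    have := h2 hx.1
    rw [Finset.mem_union] at this
    tauto
  have hZball : Z ⊆ M.ball (univ.image pv) (4 * l - 8) :=
    h4.trans (M.ball_mono _ ((Finset.card_le_card hZX).trans hXcard))
  have hreg : M.IsRegion A B X (univ.image pv) (univ.image pe) Z := by
    refine ⟨h1, h2, h5, fun e he ht ↦ ?_, hB, hP.edges_subset_inner⟩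
    have h6 := hA he
    rw [mem_inner] at h6
    rw [mem_touching] at ht
    rcases ht with ht | ht
    · exact Finset.disjoint_left.1 hdist (hZball ht) h6.1
    · exact Finset.disjoint_left.1 hdist (hZball ht) h6.2
  have hcut := hreg.card_cut_le hM hP hX
  have hcA := Finset.card_le_card (M.leaving_subset_inner Z (Z ∩ X) A)
  have hcB := Finset.card_le_card (M.leaving_subset_inner Z (Z ∩ X) B)
  have hR : #(Z \ X) ≤ l + 1 := by
    rw [← hP.card_verts]
    refine Finset.card_le_card fun x hx ↦ ?_
    rw [Finset.mem_sdiff] at hx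
    have := h2 hx.1
    rw [Finset.mem_union] at this
    tauto
  have hsplit := Finset.card_inter_add_card_sdiff Z X
  have hsplit' := Finset.card_sdiff_add_card_eq_card h1
  have hVZ := Finset.card_add_card_compl Z
  have hZXc := Finset.card_le_card hZX
  have hPc := hP.card_verts
  have hkey : #Z + 2 ≤ #(M.cut Z) := by
    have := hK Z (Finset.card_pos.1 (by omega)) (Finset.card_pos.1 (by omega))
    omega
  have hball : Z ⊆ M.ball (univ.image pv) (2 * l - 6) :=
    h4.trans (M.ball_mono _ (by omega))
  have hD : #(Z ∩ X) ≤ #(M.leaving Z (Z ∩ X) A) + #(M.leaving Z (Z ∩ X) B) := by omega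
  have hfin : #(M.inner B) ≤
      2 * #(M.inner Aᶜ ∩ M.touching Z) + #(M.inner Bᶜ ∩ M.touching Z) := by
    rcases hX with hX | hX
    · exact hreg.card_inner_le_of_agree hM hP (by omega) hX h3 hD
    · exact hreg.card_inner_le_of_opposite hM hP hX hD
  have htouch : M.touching Z ⊆ M.touching (M.ball (univ.image pv) (2 * l - 6)) := by
    intro e he
    rw [mem_touching] at he ⊢
    exact he.imp (fun h ↦ hball h) (fun h ↦ hball h)
  have h6 := Finset.card_le_card (Finset.inter_subset_inter (Finset.Subset.refl (M.inner Aᶜ)) htouch)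
  have h7 := Finset.card_le_card (Finset.inter_subset_inter (Finset.Subset.refl (M.inner Bᶜ)) htouch)
  omega

/-! ### Combining the local estimates -/

lemma exists_mem_ball_add {B C : Finset V} {r s : ℕ} {y : V} (hy : y ∈ M.ball C r)
    (hy' : y ∈ M.ball B s) : ∃ p ∈ C, p ∈ M.ball B (s + r) := by
  induction r generalizing y s with
  | zero => exact ⟨y, hy, hy'⟩
  | succ r ih =>
    simp only [ball, Finset.mem_union, Finset.mem_filter, Finset.mem_univ, true_and] at hy
    rcases hy with hy | ⟨x, hx, e, hJ⟩
    · obtain ⟨p, hp, hp'⟩ := ih hy hy'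
      exact ⟨p, hp, M.ball_mono B (by omega) hp'⟩
    · obtain ⟨p, hp, hp'⟩ := ih hx (mem_ball_succ hy' hJ.symm)
      exact ⟨p, hp, by rwa [show s + (r + 1) = s + 1 + r by omega]⟩

/-- The sets of edges touching two balls are disjoint if the centres are far apart. -/
lemma disjoint_touching_ball {B C : Finset V} {r : ℕ}
    (h : Disjoint (M.ball B (2 * r + 1)) C) :
    Disjoint (M.touching (M.ball B r)) (M.touching (M.ball C r)) := by
  rw [Finset.disjoint_left]
  intro e he he'
  obtain ⟨x, hx, y, hJ⟩ := M.exists_joins_of_mem_touching he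
  have hx1 := M.ball_mono B (Nat.le_succ r) hx
  have hy1 := mem_ball_succ hx hJ
  obtain ⟨z, hz, hz'⟩ : ∃ z ∈ M.ball C r, z ∈ M.ball B (r + 1) := by
    rcases hJ.mem_touching.1 he' with h1 | h1
    exacts [⟨x, h1, hx1⟩, ⟨y, h1, hy1⟩]
  obtain ⟨p, hp, hp'⟩ := exists_mem_ball_add hz hz'
  rw [show r + 1 + r = 2 * r + 1 by omega] at hp'
  exact Finset.disjoint_left.1 h hp' hp

lemma card_add_le_card_ball {h : ℕ} (hK : M.CutBound h) (hh : 2 ≤ h) {B C : Finset V}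
    (hB : B.Nonempty) (hC : C.Nonempty) {r : ℕ} (hd : Disjoint (M.ball B r) C) :
    #B + r ≤ #(M.ball B r) := by
  induction r with
  | zero => simp [ball]
  | succ r ih =>
    have hd' : Disjoint (M.ball B r) C :=
      Finset.disjoint_of_subset_left (M.ball_mono B (Nat.le_succ r)) hd
    have h1 := ih hd'
    obtain ⟨c, hc⟩ := hC
    have hcut := hK (M.ball B r) (hB.mono (M.ball_mono B (Nat.zero_le r)))
      ⟨c, by simpa using Finset.disjoint_right.1 hd' hc⟩
    obtain ⟨e, he⟩ : (M.cut (M.ball B r)).Nonempty := Finset.card_pos.1 (by omega)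
    obtain ⟨x, hx, y, hy, hJ⟩ := M.exists_joins_of_mem_cut he
    have : M.ball B r ⊂ M.ball B (r + 1) :=
      Finset.ssubset_iff_of_subset (M.ball_mono B (Nat.le_succ r)) |>.2
        ⟨y, mem_ball_succ hx hJ, hy⟩
    have := Finset.card_lt_card this
    omega

/-- The local estimates for the six ordered pairs of paths add up to a contradiction with the
excess of three in each of the three barriers. -/
theorem exists_isPerfectMatching_avoid (hM : M.IsCubic) {l : ℕ}
    (hK : M.CutBound (max (4 * l - 5) 2)) {pv : Fin 3 → Fin (l + 1) → V} {pe : Fin 3 → Fin l → E}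
    (hP : ∀ k, M.IsPath (pv k) (pe k))
    (hdist : ∀ j k, j ≠ k → ∀ r < 8 * l - 17,
      Disjoint (M.ball (univ.image (pv j)) r) (univ.image (pv k))) :
    ∃ k, ∃ N : (M.avoid (univ.image (pe k))).Subgraph, N.IsPerfectMatching := by
  by_contra! hcon
  have hbig : 3 ≤ l → 10 * l - 16 ≤ Fintype.card V := by
    intro hl
    have hd := hdist 0 1 (by decide) (8 * l - 18) (by omega)
    have h1 := card_add_le_card_ball hK (le_max_right _ _)
      (Finset.card_pos.1 (by rw [(hP 0).card_verts]; omega))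
      (Finset.card_pos.1 (by rw [(hP 1).card_verts]; omega)) hd
    have h2 := Finset.card_le_univ
      (M.ball (univ.image (pv 0)) (8 * l - 18) ∪ univ.image (pv 1))
    rw [Finset.card_union_of_disjoint hd] at h2
    rw [(hP 0).card_verts] at h1
    rw [(hP 1).card_verts] at h2
    omega
  have hbar := fun k ↦ exists_card_inner_eq hM hK (hP k) hbig (by
    rintro ⟨N, hN⟩
    exact hcon k N hN)
  have hl : 3 ≤ l := (hbar 0).1
  choose A hA hAc using fun k ↦ (hbar k).2
  set T : Fin 3 → Finset E := fun j ↦ M.touching (M.ball (univ.image (pv j)) (2 * l - 6)) with hT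
  have hlocal : ∀ i j, i ≠ j →
      #(M.inner (A j)) ≤ 2 * #(M.inner (A i)ᶜ ∩ T j) + #(M.inner (A j)ᶜ ∩ T j) := by
    intro i j hij
    exact card_inner_le_of_far hM hK (hP j) hl (hbig hl)
      ((hA i).trans (hP i).edges_subset_inner) (hA j) (hAc i) (hAc j)
      ((Finset.card_le_card (hA i)).trans (hP i).card_edges.le)
      (hdist j i hij.symm _ (by omega))
  have hsum : ∀ i, #(M.inner (A i)ᶜ ∩ T 0) + #(M.inner (A i)ᶜ ∩ T 1) + #(M.inner (A i)ᶜ ∩ T 2)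
      ≤ #(M.inner (A i)ᶜ) := by
    intro i
    rw [← Fin.sum_univ_three fun j ↦ #(M.inner (A i)ᶜ ∩ T j), ← Finset.card_biUnion]
    · exact Finset.card_le_card (Finset.biUnion_subset.2 fun j _ ↦ Finset.inter_subset_left)
    · intro j _ k _ hjk
      exact Finset.disjoint_of_subset_left Finset.inter_subset_right
        (Finset.disjoint_of_subset_right Finset.inter_subset_right
          (disjoint_touching_ball (hdist j k hjk _ (by omega))))
  have h0 := hsum 0
  have h1 := hsum 1
  have h2 := hsum 2
  have := hlocal 0 1 (by decide)
  have := hlocal 0 2 (by decide)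
  have := hlocal 1 0 (by decide)
  have := hlocal 1 2 (by decide)
  have := hlocal 2 0 (by decide)
  have := hlocal 2 1 (by decide)
  have := hAc 0
  have := hAc 1
  have := hAc 2
  omega

/-- A perfect matching of the underlying simple graph lifts to a set of edges of the multigraph. -/
lemma exists_matching_edges {F : Finset E} {N : (M.avoid F).Subgraph} (hN : N.IsPerfectMatching) :
    ∃ K : Set E, (∀ e ∈ K, e ∉ F) ∧
      ∀ x, ∃ e ∈ K, e ∈ M.touching {x} ∧ (∀ f ∈ K, f ∈ M.touching {x} → f = e) ∧
        ∀ f ∈ K, f ∉ M.inner {x} := by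
  have hJ : ∀ e x y, M.Joins e x y ↔ s(M.fst e, M.snd e) = s(x, y) := by
    intro e x y
    rw [Sym2.eq_iff, Joins]
  have hedge : ∀ s ∈ N.edgeSet, ∃ e ∉ F, s(M.fst e, M.snd e) = s := by
    intro s
    induction s with
    | _ x y =>
      intro hs
      obtain ⟨-, e, he, hJe⟩ := N.adj_sub (SimpleGraph.Subgraph.mem_edgeSet.1 hs)
      exact ⟨e, he, (hJ _ _ _).1 hJe⟩
  rw [SimpleGraph.Subgraph.isPerfectMatching_iff] at hN
  rcases isEmpty_or_nonempty V with hV | ⟨⟨x₀⟩⟩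
  · exact ⟨∅, by simp, fun x ↦ hV.elim x⟩
  have : Nonempty E := by
    obtain ⟨y, hy, -⟩ := hN x₀
    exact ⟨(hedge _ (SimpleGraph.Subgraph.mem_edgeSet.2 hy)).choose⟩
  choose! c hcF hc using hedge
  have hval : ∀ x y, N.Adj x y → M.Joins (c s(x, y)) x y := fun x y h ↦
    (hJ _ _ _).2 (hc _ (SimpleGraph.Subgraph.mem_edgeSet.2 h))
  refine ⟨c '' N.edgeSet, ?_, fun x ↦ ?_⟩
  · rintro _ ⟨s, hs, rfl⟩
    exact hcF s hs
  · obtain ⟨y, hy, huniq⟩ := hN x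
    refine ⟨c s(x, y), ⟨_, SimpleGraph.Subgraph.mem_edgeSet.2 hy, rfl⟩,
      (hval x y hy).mem_touching.2 (by simp), ?_, ?_⟩
    · rintro _ ⟨s, hs, rfl⟩ ht
      induction s with
      | _ a b =>
        rw [SimpleGraph.Subgraph.mem_edgeSet] at hs
        rw [(hval a b hs).mem_touching, Finset.mem_singleton, Finset.mem_singleton] at ht
        rcases ht with rfl | rfl
        · rw [huniq b hs]
        · rw [huniq a hs.symm, Sym2.eq_swap]
    · rintro _ ⟨s, hs, rfl⟩ ht
      induction s with
      | _ a b =>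
        rw [SimpleGraph.Subgraph.mem_edgeSet] at hs
        rw [(hval a b hs).mem_inner, Finset.mem_singleton, Finset.mem_singleton] at ht
        exact hs.ne (ht.1.trans ht.2.symm)

end Multigraph

/-! ### Transfer to `Graph` -/

namespace Graph

open Finset Multigraph
open scoped Classical

set_option linter.unusedSectionVars false

variable {α β : Type*} (G : Graph α β)

/-- The multigraph on the vertices and the edges of `G`, with an arbitrary choice of the order of
the two ends of each edge. -/
noncomputable def toMultigraph : Multigraph G.vertexSet G.edgeSet where
  fst e := ⟨(G.exists_isLink_of_mem_edgeSet e.2).choose,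
    (G.exists_isLink_of_mem_edgeSet e.2).choose_spec.choose_spec.left_mem⟩
  snd e := ⟨(G.exists_isLink_of_mem_edgeSet e.2).choose_spec.choose,
    (G.exists_isLink_of_mem_edgeSet e.2).choose_spec.choose_spec.right_mem⟩

variable {G}

lemma isLink_fst_snd (e : G.edgeSet) :
    G.IsLink e (G.toMultigraph.fst e) (G.toMultigraph.snd e) :=
  (G.exists_isLink_of_mem_edgeSet e.2).choose_spec.choose_spec

lemma toMultigraph_joins {e : G.edgeSet} {x y : G.vertexSet} :
    G.toMultigraph.Joins e x y ↔ G.IsLink e x y := by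
  rw [(isLink_fst_snd e).isLink_iff, Joins]
  simp only [Subtype.ext_iff]

variable [Fintype G.vertexSet] [Fintype G.edgeSet]

lemma inc_iff_mem_touching {e : G.edgeSet} {x : G.vertexSet} :
    G.Inc e x ↔ e ∈ G.toMultigraph.touching {x} := by
  rw [Multigraph.mem_touching, Finset.mem_singleton, Finset.mem_singleton]
  constructor
  · rintro ⟨y, hy⟩
    have hJ : G.toMultigraph.Joins e x ⟨y, hy.right_mem⟩ := toMultigraph_joins.2 hy
    exact hJ.imp And.left And.right
  · rintro (rfl | rfl)
    · exact (isLink_fst_snd e).inc_left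
    · exact (isLink_fst_snd e).inc_right

lemma isLoopAt_iff_mem_inner {e : G.edgeSet} {x : G.vertexSet} :
    G.IsLoopAt e x ↔ e ∈ G.toMultigraph.inner {x} := by
  rw [Multigraph.mem_inner, Finset.mem_singleton, Finset.mem_singleton, ← isLink_self_iff,
    ← toMultigraph_joins, Joins]
  tauto

lemma isCubic_toMultigraph (h : G.IsRegularOfDegree 3) : G.toMultigraph.IsCubic := by
  intro x
  have h1 : ∑ e, G.toMultigraph.ends {x} e =
      #(G.toMultigraph.touching {x}) + #(G.toMultigraph.inner {x}) := by
    rw [touching, Multigraph.inner, Finset.card_filter, Finset.card_filter, ← Finset.sum_add_distrib]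
    refine Finset.sum_congr rfl fun e _ ↦ ?_
    unfold ends
    by_cases h1 : G.toMultigraph.fst e ∈ ({x} : Finset G.vertexSet) <;>
      by_cases h2 : G.toMultigraph.snd e ∈ ({x} : Finset G.vertexSet) <;> simp [h1, h2]
  have h2 : G.incidenceSet x = Subtype.val '' (G.toMultigraph.touching {x} : Set G.edgeSet) := by
    ext e
    simp only [mem_incidenceSet, Set.mem_image, Finset.mem_coe, Subtype.exists,
      exists_and_right, exists_eq_right]
    exact ⟨fun he ↦ ⟨he.edge_mem, inc_iff_mem_touching.1 he⟩,
      fun ⟨_, he⟩ ↦ inc_iff_mem_touching.2 he⟩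
  have h3 : G.loopSet x = Subtype.val '' (G.toMultigraph.inner {x} : Set G.edgeSet) := by
    ext e
    simp only [mem_loopSet, Set.mem_image, Finset.mem_coe, Subtype.exists,
      exists_and_right, exists_eq_right]
    exact ⟨fun he ↦ ⟨he.edge_mem, isLoopAt_iff_mem_inner.1 he⟩,
      fun ⟨_, he⟩ ↦ isLoopAt_iff_mem_inner.2 he⟩
  have h4 := h x x.2
  rw [eDegree, h2, h3, Subtype.val_injective.encard_image, Subtype.val_injective.encard_image,
    Set.encard_coe_eq_coe_finsetCard, Set.encard_coe_eq_coe_finsetCard] at h4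
  rw [h1]
  exact_mod_cast h4

lemma hasCircuitIn_of_hasCircuit {W : Finset G.vertexSet} (h : G.toMultigraph.HasCircuit W) :
    G.HasCircuitIn (Subtype.val '' (W : Set G.vertexSet)) := by
  obtain ⟨n, v, e, h1, h2, h3, h4, h5⟩ := h
  refine ⟨n, fun i ↦ v i, fun i ↦ e i, ⟨fun i ↦ ?_, fun i j hij ↦ ?_, fun i j hij ↦ ?_⟩, fun i ↦ ?_⟩
  · rw [← toMultigraph_joins]
    rcases Fin.eq_castSucc_or_eq_last i with ⟨j, rfl⟩ | rfl
    · simpa using h1 j j.2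
    · simpa using h2
  · exact Fin.ext (h3 (Nat.lt_succ_iff.1 i.2) (Nat.lt_succ_iff.1 j.2) (Subtype.ext hij))
  · exact Fin.ext (h4 (Nat.lt_succ_iff.1 i.2) (Nat.lt_succ_iff.1 j.2) (Subtype.ext hij))
  · exact ⟨v i, h5 i (Nat.lt_succ_iff.1 i.2), rfl⟩

lemma cutBound_toMultigraph (hM : G.toMultigraph.IsCubic) {h : ℕ}
    (hc : G.IsCyclicallyEdgeConnected h) : G.toMultigraph.CutBound h := by
  refine hM.cutBound fun W h1 h2 ↦ ?_
  have hcompl : ∀ U : Finset G.vertexSet, (∀ x, x ∈ U ↔ x ∉ W) →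
      Subtype.val '' (U : Set G.vertexSet) =
        G.vertexSet \ (Subtype.val '' (W : Set G.vertexSet)) := by
    intro U hU
    ext x
    simp [hU]
    grind
  have hcut : G.edgeCut (Subtype.val '' (W : Set G.vertexSet)) ⊆
      Subtype.val '' (G.toMultigraph.cut W : Set G.edgeSet) := by
    rintro e ⟨x, y, hl, ⟨x', hx, rfl⟩, hy⟩
    refine ⟨⟨e, hl.edge_mem⟩, ?_, rfl⟩
    have hJ : G.toMultigraph.Joins ⟨e, hl.edge_mem⟩ x' ⟨y, hl.right_mem⟩ :=
      toMultigraph_joins.2 hl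
    rw [Finset.mem_coe, hJ.mem_cut]
    have hy' : (⟨y, hl.right_mem⟩ : G.vertexSet) ∉ W := fun h ↦ hy ⟨_, h, rfl⟩
    have hx' : x' ∈ W := hx
    tauto
  have h2' := hasCircuitIn_of_hasCircuit h2
  rw [hcompl _ (by simp)] at h2'
  have h3 := hc _ (by rintro _ ⟨x, -, rfl⟩; exact x.2) (hasCircuitIn_of_hasCircuit h1) h2'
  have h4 := h3.trans (Set.encard_le_encard hcut)
  rw [Subtype.val_injective.encard_image, Set.encard_coe_eq_coe_finsetCard] at h4
  exact_mod_cast h4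

lemma exists_isWalk_of_mem_ball {B : Finset G.vertexSet} {r : ℕ} {x : G.vertexSet}
    (hx : x ∈ G.toMultigraph.ball B r) :
    ∃ p ∈ B, ∃ n ≤ r, ∃ (v : Fin (n + 1) → α) (e : Fin n → β),
      G.IsWalk v e ∧ v 0 = x ∧ v (Fin.last n) = p := by
  induction r generalizing x with
  | zero =>
    exact ⟨x, hx, 0, le_rfl, fun _ ↦ x, Fin.elim0, ⟨fun _ ↦ x.2, fun i ↦ i.elim0⟩, rfl, rfl⟩
  | succ r ih =>
    simp only [ball, Finset.mem_union, Finset.mem_filter, Finset.mem_univ, true_and] at hx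
    rcases hx with hx | ⟨y, hy, f, hJ⟩
    · obtain ⟨p, hp, n, hn, hw⟩ := ih hx
      exact ⟨p, hp, n, by omega, hw⟩
    · obtain ⟨p, hp, n, hn, v, e, hw, h0, hlast⟩ := ih hy
      refine ⟨p, hp, n + 1, by omega, Fin.cons x.1 v, Fin.cons f.1 e, ⟨?_, ?_⟩, rfl, ?_⟩
      · intro i
        cases i using Fin.cases with
        | zero => exact x.2
        | succ i => exact hw.vert_mem i
      · intro i
        cases i using Fin.cases with
        | zero =>
          have := toMultigraph_joins.1 hJ.symm
          simpa [h0] using this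
        | succ i => simpa [← Fin.succ_castSucc] using hw.isLink i
      · rw [← Fin.succ_last, Fin.cons_succ, hlast]

lemma disjoint_ball_of_le_setEDist {B C : Finset G.vertexSet} {S T : Set α} {d : ℕ}
    (hB : ∀ x ∈ B, x.1 ∈ T) (hC : ∀ x ∈ C, x.1 ∈ S) (h : (d : ℕ∞) ≤ G.setEDist S T) {r : ℕ}
    (hr : r < d) : Disjoint (G.toMultigraph.ball B r) C := by
  rw [Finset.disjoint_left]
  intro x hx hxC
  obtain ⟨p, hp, n, hn, hw⟩ := exists_isWalk_of_mem_ball hx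
  have h1 : G.setEDist S T ≤ n :=
    (iInf₂_le x.1 (hC x hxC)).trans ((iInf₂_le p.1 (hB p hp)).trans (iInf₂_le n hw))
  have h2 : d ≤ n := by exact_mod_cast h.trans h1
  omega

/-- Deleting the edges of a perfect matching from a cubic graph leaves a `2`-factor. -/
lemma isTwoFactor_deleteEdges (h : G.IsRegularOfDegree 3) {K : Set G.edgeSet}
    (hK : ∀ x, ∃ e ∈ K, e ∈ G.toMultigraph.touching {x} ∧
      (∀ f ∈ K, f ∈ G.toMultigraph.touching {x} → f = e) ∧
        ∀ f ∈ K, f ∉ G.toMultigraph.inner {x}) :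
    (G.deleteEdges (Subtype.val '' K)).IsTwoFactor G := by
  refine ⟨⟨deleteEdges_le, by simp⟩, fun x hx ↦ ?_⟩
  rw [vertexSet_deleteEdges] at hx
  obtain ⟨e, heK, he, huniq, hloop⟩ := hK ⟨x, hx⟩
  have h1 : G.incidenceSet x =
      insert e.1 ((G.deleteEdges (Subtype.val '' K)).incidenceSet x) := by
    ext f
    simp only [mem_incidenceSet, Set.mem_insert_iff, deleteEdges_inc]
    constructor
    · intro hf
      by_cases hfK : f ∈ Subtype.val '' K
      · obtain ⟨f, hfK, rfl⟩ := hfK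
        exact Or.inl (congrArg _ (huniq f hfK (inc_iff_mem_touching.1 hf)))
      · exact Or.inr ⟨hf, hfK⟩
    · rintro (rfl | hf)
      · exact inc_iff_mem_touching.2 he
      · exact hf.1
  have h2 : (G.deleteEdges (Subtype.val '' K)).loopSet x = G.loopSet x := by
    ext f
    simp only [mem_loopSet, deleteEdges_isLoopAt, and_iff_left_iff_imp]
    rintro hf ⟨f, hfK, rfl⟩
    exact hloop f hfK (isLoopAt_iff_mem_inner.1 hf)
  have h3 : e.1 ∉ (G.deleteEdges (Subtype.val '' K)).incidenceSet x := by
    rw [mem_incidenceSet, deleteEdges_inc]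
    exact fun hh ↦ hh.2 ⟨e, heK, rfl⟩
  have h4 := h x hx
  rw [eDegree, h1, Set.encard_insert_of_notMem h3, ← h2, add_right_comm, ← eDegree] at h4
  have h5 : (G.deleteEdges (Subtype.val '' K)).eDegree x + 1 = 2 + 1 := by
    rw [h4]; norm_num
  exact (ENat.add_left_injective_of_ne_top ENat.one_ne_top) h5

end Graph

/-- The path `P k`, for `k : Fin 3`, has the vertices `v k 0, …, v k l` and the edges
`e k 0, …, e k (l - 1)`. Subtraction is truncated, which changes neither maximum. -/
theorem theorem4 {α β : Type*} (G : Graph α β)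
    (hV : G.vertexSet.Finite) (hE : G.edgeSet.Finite)
    (l : ℕ)
    (hcubic : G.IsRegularOfDegree 3)
    (hcyc : G.IsCyclicallyEdgeConnected (max (4 * l - 5) 2))
    (v : Fin 3 → Fin (l + 1) → α) (e : Fin 3 → Fin l → β)
    (hP : ∀ k, G.IsPath (v k) (e k))
    (hdist : ∀ j k, j ≠ k →
      ((max (8 * l - 17) 0 : ℕ) : ℕ∞) ≤ G.setEDist (Set.range (v j)) (Set.range (v k))) :
    ∃ H : Graph α β, H.IsTwoFactor G ∧ ∃ k, H.IsPath (v k) (e k) := by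
  have := hV.fintype
  have := hE.fintype
  have hM := Graph.isCubic_toMultigraph hcubic
  have hpath : ∀ k, G.toMultigraph.IsPath (fun i ↦ ⟨v k i, (hP k).vert_mem i⟩)
      (fun i ↦ ⟨e k i, ((hP k).isLink i).edge_mem⟩) := fun k ↦
    ⟨fun i j hij ↦ (hP k).vert_injective (congrArg Subtype.val hij),
      fun i ↦ Graph.toMultigraph_joins.2 ((hP k).isLink i)⟩
  obtain ⟨k, N, hN⟩ := Multigraph.exists_isPerfectMatching_avoid hM
    (Graph.cutBound_toMultigraph hM hcyc) hpath fun j k hjk r hr ↦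
      Graph.disjoint_ball_of_le_setEDist (by simp) (by simp) (hdist k j hjk.symm) (by omega)
  obtain ⟨K, hKF, hK⟩ := Multigraph.exists_matching_edges hN
  refine ⟨_, Graph.isTwoFactor_deleteEdges hcubic hK, k, ⟨⟨?_, fun i ↦ ?_⟩, (hP k).vert_injective⟩⟩
  · simpa using (hP k).vert_mem
  · rw [Graph.deleteEdges_isLink]
    refine ⟨(hP k).isLink i, ?_⟩
    rintro ⟨f, hf, hfe⟩
    refine hKF f hf ?_
    simp only [Finset.mem_image]
    exact ⟨i, Finset.mem_univ _, Subtype.ext hfe.symm⟩
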